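/- Let $\Gamma$ and $\Lambda$ be groups generated by finite sets $S$ and $S'$ respectively, equipped with the word metrics. Let $(M,d)$ be a compact (connected) Riemannian manifold with its Riemannian distance, and let $\Gamma\curvearrowright M$ be an action by isometries which is essentially free, i.e. the set of points with nontrivial stabilizer has Riemannian volume zero. For $t\ge 1$ let $\delta_\Gamma^{t}$ be the warped distance on $M$, i.e. the largest metric on $M$ with $\delta_\Gamma^t(x,y)\le t\,d(x,y)$ for all $x,y\in M$ and $\delta_\Gamma^t(x,s\cdot x)\le 1$ for all $x\in M$, $s\in S$; the metric space $(M,\delta_\Gamma^t)$ is the $t$-level of the warped cone. Let $(t_k)_{k\in\mathbb N}$ be an increasing sequence in $[1,\infty)$ tending to infinity. Two sequences of metric spaces $(X_k)$ and $(Y_k)$ are called uniformly coarsely equivalent if there are increasing unbounded functions $\rho_-,\rho_+\colon[0,\infty)\to[0,\infty)$, a constant $C>0$, and maps $f_k\colon X_k\to Y_k$ such that for every $k$ one has $\rho_-(d_{X_k}(x,x'))\le d_{Y_k}(f_k(x),f_k(x'))\le\rho_+(d_{X_k}(x,x'))$ for all $x,x'\in X_k$, and every point of $Y_k$ is at distance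 at most $C$ from $f_k(X_k)$. (i) Suppose that $\Lambda$ acts essentially freely by isometries on a compact (connected) Riemannian manifold $N$ and that, for some increasing sequence $(s_k)_{k\in\mathbb N}$ in $[1,\infty)$ tending to infinity, the sequences $\{(M,\delta_\Gamma^{t_k})\}_k$ and $\{(N,\delta_\Lambda^{s_k})\}_k$ are uniformly coarsely equivalent, where $\delta_\Lambda^{s}$ is defined as above using $S'$. Then $\Gamma\times\mathbb Z^{\dim M}$ is quasi-isometric to $\Lambda\times\mathbb Z^{\dim N}$. (ii) Suppose that $(\Lambda_k)_{k\in\mathbb N}$ is a sequence of finite index normal subgroups of $\Lambda$ with $\Lambda_{k+1}\le\Lambda_k$ for all $k$ and $\bigcap_k\Lambda_k=\{1\}$, and that the sequence of Cayley graphs $\{\mathrm{Cay}(\Lambda/\Lambda_k,\pi_k(S'))\}_k$, where $\pi_k\colon\Lambda\to\Lambda/\Lambda_k$ is the quotient map, is uniformly coarsely equivalent to $\{(M,\delta_\Gamma^{t_k})\}_k$. Then $\Lambda$ is quasi-isometric to $\Gamma\times\mathbb Z^{\dim M}$. -/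

import Mathlib

open Filter MeasureTheory
open scoped Bundle Manifold ContDiff

/-! ### Metrics, quasi-isometries and coarse equivalences -/

/-- The function `d` is a metric on `X` (nonnegativity follows from these axioms). Distances are
passed around as functions because one space `X` carries many metrics below. -/
structure IsMetric {X : Type*} (d : X → X → ℝ) : Prop where
  self : ∀ x, d x x = 0
  eq_of_eq_zero : ∀ x y, d x y = 0 → x = y
  symm : ∀ x y, d x y = d y x
  triangle : ∀ x y z, d x z ≤ d x y + d y z

/-- `f` is an `(L, A)`-quasi-isometry from `(X, dX)` to `(Y, dY)`. -/
def IsQuasiIsometry {X Y : Type*} (dX : X → X → ℝ) (dY : Y → Y → ℝ) (L A : ℝ) (f : X → Y) :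
    Prop :=
  (∀ x₁ x₂, 1 / L * dX x₁ x₂ - A ≤ dY (f x₁) (f x₂) ∧ dY (f x₁) (f x₂) ≤ L * dX x₁ x₂ + A) ∧
    ∀ y, ∃ x, dY y (f x) ≤ A

/-- `(X, dX)` and `(Y, dY)` are quasi-isometric. -/
def QuasiIsometric {X Y : Type*} (dX : X → X → ℝ) (dY : Y → Y → ℝ) : Prop :=
  ∃ L A : ℝ, 1 ≤ L ∧ 0 ≤ A ∧ ∃ f : X → Y, IsQuasiIsometry dX dY L A f

/-- An increasing and unbounded control function `[0, ∞) → [0, ∞)`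
(only the values on `[0, ∞)` matter). -/
structure IsControlFunction (ρ : ℝ → ℝ) : Prop where
  nonneg : ∀ r, 0 ≤ r → 0 ≤ ρ r
  mono : MonotoneOn ρ (Set.Ici 0)
  unbounded : Tendsto ρ atTop atTop

/-- `f` is a coarse equivalence from `(X, dX)` to `(Y, dY)` with control functions `ρ₁`, `ρ₂`
and with `C`-dense image. -/
def IsCoarseEquivalence {X Y : Type*} (dX : X → X → ℝ) (dY : Y → Y → ℝ) (ρ₁ ρ₂ : ℝ → ℝ) (C : ℝ)
    (f : X → Y) : Prop :=
  (∀ x₁ x₂, ρ₁ (dX x₁ x₂) ≤ dY (f x₁) (f x₂) ∧ dY (f x₁) (f x₂) ≤ ρ₂ (dX x₁ x₂)) ∧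
    ∀ y, ∃ x, dY y (f x) ≤ C

/-- The sequences `(X k, dX k)` and `(Y k, dY k)` are uniformly coarsely equivalent: there are
coarse equivalences `X k → Y k` with control functions and density constant independent of `k`. -/
def UniformlyCoarselyEquivalent {X Y : ℕ → Type*} (dX : ∀ k, X k → X k → ℝ)
    (dY : ∀ k, Y k → Y k → ℝ) : Prop :=
  ∃ ρ₁ ρ₂ : ℝ → ℝ, IsControlFunction ρ₁ ∧ IsControlFunction ρ₂ ∧ ∃ C : ℝ, 0 < C ∧
    ∀ k, ∃ f : X k → Y k, IsCoarseEquivalence (dX k) (dY k) ρ₁ ρ₂ C f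

/-! ### Word metrics -/

/-- The word metric on `G` given by `S`: the path metric on the vertices of the Cayley graph
of `G` with respect to `S`. -/
noncomputable def wordDist {G : Type*} [Group G] (S : Set G) (g h : G) : ℝ :=
  ((SimpleGraph.mulCayley S).dist g h : ℝ)

/-- The `ℓ¹`-metric on `G × ℤᵐ`, i.e. the word metric for `S` together with the standard
generators of `ℤᵐ`. -/
noncomputable def prodIntDist {G : Type*} [Group G] (S : Set G) (m : ℕ)
    (p q : G × (Fin m → ℤ)) : ℝ :=
  wordDist S p.1 q.1 + ∑ i, |(p.2 i : ℝ) - (q.2 i : ℝ)|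

/-! ### Warped cones -/

/-- The metrics `d` on `X` with `d x y ≤ t * dist x y` and `d x (s • x) ≤ 1` for `s ∈ S`. -/
def warpedMetrics {G : Type*} [Group G] {X : Type*} [MetricSpace X] [MulAction G X]
    (S : Set G) (t : ℝ) : Set (X → X → ℝ) :=
  {d | IsMetric d ∧ (∀ x y, d x y ≤ t * dist x y) ∧ ∀ s ∈ S, ∀ x, d x (s • x) ≤ 1}

/-- The warped distance at level `t`: the largest metric in `warpedMetrics S t`
(see `warpedDist_isGreatest`). The `t`-level of the warped cone is `X` with this metric. -/
noncomputable def warpedDist {G : Type*} [Group G] {X : Type*} [MetricSpace X] [MulAction G X]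
    (S : Set G) (t : ℝ) (x y : X) : ℝ :=
  sSup ((fun d : X → X → ℝ => d x y) '' warpedMetrics S t)

/-- For `t > 0` there is a largest metric in `warpedMetrics S t`, and `warpedDist S t` is it. -/
theorem warpedDist_isGreatest {G : Type*} [Group G] {X : Type*} [MetricSpace X] [MulAction G X]
    (S : Set G) (t : ℝ) (ht : 0 < t) :
    IsGreatest (warpedMetrics S t) (warpedDist S t : X → X → ℝ) := by
  have hmin : (fun x y : X => min (t * dist x y) 1) ∈ warpedMetrics (X := X) S t := by
    refine ⟨⟨fun x => by simp, fun x y h => ?_, fun x y => by simp [dist_comm],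
      fun x y z => ?_⟩, fun x y => min_le_left _ _, fun s _ x => min_le_right _ _⟩
    · rcases min_choice (t * dist x y) 1 with h' | h'
      · have : t * dist x y = 0 := h' ▸ h
        simpa [ht.ne'] using this
      · have : (1 : ℝ) = 0 := h' ▸ h
        norm_num at this
    · have h1 : t * dist x z ≤ t * dist x y + t * dist y z := by
        rw [← mul_add]; exact mul_le_mul_of_nonneg_left (dist_triangle x y z) ht.le
      have h2 : 0 ≤ t * dist x y := by positivity
      have h3 : 0 ≤ t * dist y z := by positivity
      simp only [min_def]
      split_ifs <;> linarith
  have hne : ∀ x y : X, ((fun d : X → X → ℝ => d x y) '' warpedMetrics S t).Nonempty :=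
    fun x y => ⟨_, _, hmin, rfl⟩
  have hbdd : ∀ x y : X, BddAbove ((fun d : X → X → ℝ => d x y) '' warpedMetrics S t) := by
    rintro x y
    refine ⟨t * dist x y, ?_⟩
    rintro _ ⟨d, hd, rfl⟩
    exact hd.2.1 x y
  have hle : ∀ d ∈ warpedMetrics (X := X) S t, ∀ x y, d x y ≤ warpedDist S t x y :=
    fun d hd x y => le_csSup (hbdd x y) ⟨d, hd, rfl⟩
  refine ⟨⟨⟨fun x => ?_, fun x y h => ?_, fun x y => ?_, fun x y z => ?_⟩, fun x y => ?_,
    fun s hs x => ?_⟩, fun d hd x y => hle d hd x y⟩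
  · apply le_antisymm
    · apply csSup_le (hne x x)
      rintro _ ⟨d, hd, rfl⟩
      exact (hd.1.self x).le
    · have := hle _ hmin x x
      simpa using this
  · have h1 := hle _ hmin x y
    rw [h] at h1
    refine hmin.1.eq_of_eq_zero x y (le_antisymm h1 ?_)
    have : 0 ≤ t * dist x y := by positivity
    exact le_min this zero_le_one
  · unfold warpedDist
    congr 1
    apply Set.image_congr
    exact fun d hd => hd.1.symm x y
  · apply csSup_le (hne x z)
    rintro _ ⟨d, hd, rfl⟩
    exact (hd.1.triangle x y z).trans (add_le_add (hle d hd x y) (hle d hd y z))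
  · apply csSup_le (hne x y)
    rintro _ ⟨d, hd, rfl⟩
    exact hd.2.1 x y
  · apply csSup_le (hne x _)
    rintro _ ⟨d, hd, rfl⟩
    exact hd.2.2 s hs x

/-! ### Essentially free actions -/

/-- The action of `G` on the `m`-dimensional Riemannian manifold `X` is essentially free: the
points with nontrivial stabilizer form a set of Riemannian volume zero. The Riemannian volume is,
up to a positive constant depending only on `m`, the `m`-dimensional Hausdorff measure of the
Riemannian distance. -/
def IsEssentiallyFree (G : Type*) [Group G] (m : ℕ) (X : Type*) [MetricSpace X]
    [MeasurableSpace X] [BorelSpace X] [MulAction G X] : Prop :=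
  Measure.hausdorffMeasure (m : ℝ) {x : X | MulAction.stabilizer G x ≠ ⊥} = 0

/-! For an action by isometries, all jumps in a warped path can be gathered into one: the warped
distance at level `t` is the infimum over `g` of `|g| + t * d(g x, y)`. Hence, if no short
nontrivial group element nearly fixes `x`, the `R`-ball around `x` at a high level is a
disjoint-looking pile of rescaled Euclidean pieces indexed by group elements: `(g, v) ↦ g⁻¹ • ψ(v /
t)`, with `ψ` a chart at `x`, is a quasi-isometric model of it by a ball of `Γ × ℤᵐ`, with constants
independent of `R` and `t` (`isLocalModel_warpedDist`). Likewise `Λ / Λ_k` agrees with `Λ` on balls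
whose radius tends to infinity (`isLocalModel_quotient`).

A uniform coarse equivalence between such spaces, read through the models at corresponding base
points, becomes a map between the model groups. Balls of the models are finite, so its values can be
fixed along an ultrafilter. The limit is a coarse equivalence of graph metrics, and such a map is a
quasi-isometry (`quasiIsometric_of_localModels`, `quasiIsometric_of_coarse`).

What remains is to find base points. In (ii) every point of the quotient is as good as any other, so
one free point of `M` and a coarse preimage of it suffice. In (i) both `x` and `f_k x` must avoid
the nearly fixed points. By essential freeness these have small volume on either side, but `f_k` has
no measure-theoretic properties. Counting balls replaces them: covering `M` by `O(t^m)` balls gives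
`s^n = O(t^m)`, and covering the nearly fixed points of `N` by balls of radius comparable to `1 / s`
shows that their preimage has volume tending to zero (`exists_volume_comparison`,
`exists_measure_preimage_nearFixedPoints_le`). So the bad sets cannot exhaust `M`. -/

/-! ### Uniformly bi-Lipschitz charts on compact Riemannian manifolds -/

section ChartEstimates
open Bundle Set Metric Manifold
open scoped NNReal ENNReal Topology

variable {E : Type*} [NormedAddCommGroup E] [NormedSpace ℝ E]
  {H : Type*} [TopologicalSpace H] {I : ModelWithCorners ℝ E H}
  {M : Type*} [PseudoEMetricSpace M] [ChartedSpace H M]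
  [RiemannianBundle (fun (x : M) ↦ TangentSpace I x)]
  [IsManifold I 1 M] [IsContinuousRiemannianBundle E (fun (x : M) ↦ TangentSpace I x)]
  [IsRiemannianManifold I M]

attribute [local instance] normedAddCommGroupTangentSpaceVectorSpace
attribute [local instance] normedSpaceTangentSpaceVectorSpace

variable (I)

/-- The Riemannian distance is locally bounded by a multiple of the distance in the chart. -/
lemma exists_edist_le_edist_extChartAt (x : M) :
    ∃ C : ℝ≥0, ∃ U ∈ 𝓝 x, ∀ y ∈ U, ∀ z ∈ U,
      edist y z ≤ C * edist (extChartAt I x y) (extChartAt I x z) := by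
  rcases eventually_enorm_mfderivWithin_symm_extChartAt_lt I x with ⟨C, C_pos, hC⟩
  obtain ⟨r, r_pos, hr⟩ := mem_nhdsWithin_iff.1 (inter_mem (extChartAt_target_mem_nhdsWithin x) hC)
  have A : (extChartAt I x) ⁻¹' (ball (extChartAt I x x) r ∩ range I) ∈ 𝓝 x := by
    apply extChartAt_preimage_mem_nhds_of_mem_nhdsWithin (by simp)
    rw [inter_comm]
    exact inter_mem_nhdsWithin _ (ball_mem_nhds _ r_pos)
  refine ⟨C, _, inter_mem A (chart_source_mem_nhds H x), ?_⟩
  rintro y ⟨hy, h'y⟩ z ⟨hz, h'z⟩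
  -- The segment in the chart has length equal to the chart distance; pulling it back by the inverse
  -- chart multiplies lengths by at most `C`.
  let η := ContinuousAffineMap.lineMap (R := ℝ) (extChartAt I x y) (extChartAt I x z)
  set γ := (extChartAt I x).symm ∘ η
  have hη₀ : Icc 0 1 ⊆ ⇑η ⁻¹' (ball (extChartAt I x x) r ∩ range I) := by
    simp only [← image_subset_iff, ContinuousAffineMap.coe_lineMap_eq,
     ← segment_eq_image_lineMap, η]
    exact ((convex_ball _ _).inter I.convex_range).segment_subset hy hz
  have hη := hη₀.trans (preimage_mono hr)
  simp only [preimage_inter, subset_inter_iff] at hη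
  have η_smooth : CMDiff[Icc 0 1] 1 η := by
    apply ContMDiff.contMDiffOn
    rw [contMDiff_iff_contDiff]
    exact ContinuousAffineMap.contDiff _
  have : edist y z ≤ pathELength I γ 0 1 := by
    rw [IsRiemannianManifold.out (I := I) y z]
    apply riemannianEDist_le_pathELength _ _ _ zero_le_one
    · exact (contMDiffOn_extChartAt_symm x).comp η_smooth hη.1
    · simp [γ, η, ContinuousAffineMap.coe_lineMap_eq, h'y]
    · simp [γ, η, ContinuousAffineMap.coe_lineMap_eq, h'z]
  apply this.trans
  rw [← lintegral_fderiv_lineMap_eq_edist, pathELength_eq_lintegral_mfderivWithin_Icc,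
    ← lintegral_const_mul' _ _ ENNReal.coe_ne_top]
  apply setLIntegral_mono' measurableSet_Icc (fun t ht ↦ ?_)
  have : mfderiv[Icc 0 1] γ t =
      (mfderiv[range I] (extChartAt I x).symm (η t)) ∘L (mfderiv[Icc 0 1] η t) := by
    apply mfderivWithin_comp
    · exact mdifferentiableWithinAt_extChartAt_symm (hη.1 ht)
    · exact η_smooth.mdifferentiableOn one_ne_zero t ht
    · exact hη.1.trans (preimage_mono (extChartAt_target_subset_range x))
    · rw [uniqueMDiffWithinAt_iff_uniqueDiffWithinAt]
      exact uniqueDiffOn_Icc zero_lt_one t ht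
  have : mfderiv[Icc 0 1] γ t 1 =
      (mfderiv[range I] (extChartAt I x).symm (η t)) (mfderiv[Icc 0 1] η t 1) := congr($this 1)
  rw [this]
  apply (ContinuousLinearMap.le_opENorm _ _).trans
  gcongr
  · exact (hη.2 ht).le
  · simp only [mfderivWithin_eq_fderivWithin]
    exact le_of_eq rfl

/-- The distance in the chart is locally bounded by a multiple of the Riemannian distance. -/
lemma exists_edist_extChartAt_le_edist (x : M) :
    ∃ C : ℝ≥0, ∃ U ∈ 𝓝 x, ∀ y ∈ U, ∀ z ∈ U,
      edist (extChartAt I x y) (extChartAt I x z) ≤ C * edist y z := by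
  rcases eventually_enorm_mfderiv_extChartAt_lt I x with ⟨C, C_pos, hC⟩
  obtain ⟨ρ, ρ_pos, hρ⟩ := EMetric.mem_nhds_iff.1
    (inter_mem hC (chart_source_mem_nhds H x))
  -- Two points of the `ρ / 3`-ball are joined by paths of length below `2ρ / 3`, and these cannot
  -- leave the `ρ`-ball, where the derivative of the chart is controlled.
  refine ⟨C, eball x (ρ / 3), eball_mem_nhds x (ENNReal.div_pos ρ_pos.ne' (by simp)), ?_⟩
  intro y hy z hz
  have hyz : edist y z < ρ / 3 + ρ / 3 :=
    (edist_triangle_right y z x).trans_lt (ENNReal.add_lt_add hy hz)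
  have key : ∀ r : ℝ≥0∞, edist y z < r → r < ρ / 3 + ρ / 3 →
      edist (extChartAt I x y) (extChartAt I x z) ≤ C * r := by
    intro r hr hrρ
    rw [IsRiemannianManifold.out (I := I) y z] at hr
    rcases exists_lt_locally_constant_of_riemannianEDist_lt hr zero_lt_one
      with ⟨γ, hγy, hγz, γ_smooth, hγ, -⟩
    have hmem : ∀ t ∈ Icc (0 : ℝ) 1, γ t ∈ eball x ρ := by
      intro t ht
      have h1 : edist (γ t) y < ρ / 3 + ρ / 3 := by
        rw [edist_comm, IsRiemannianManifold.out (I := I) y (γ t)]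
        calc riemannianEDist I y (γ t) ≤ pathELength I γ 0 t :=
              riemannianEDist_le_pathELength γ_smooth.contMDiffOn hγy rfl ht.1
          _ ≤ pathELength I γ 0 1 := pathELength_mono le_rfl ht.2
          _ < _ := hγ.trans hrρ
      calc edist (γ t) x ≤ edist (γ t) y + edist y x := edist_triangle _ _ _
        _ < (ρ / 3 + ρ / 3) + ρ / 3 := ENNReal.add_lt_add h1 hy
        _ = ρ := ENNReal.add_thirds ρ
    have hu : ∀ t ∈ Icc (0 : ℝ) 1, _ := fun t ht => (hρ (hmem t ht)).1
    have uc : ∀ t ∈ Icc (0 : ℝ) 1, γ t ∈ (chartAt H x).source := fun t ht => (hρ (hmem t ht)).2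
    let γ' := extChartAt I x ∘ γ
    have hC : CMDiff[Icc 0 1] 1 γ' :=
      contMDiffOn_extChartAt.comp (I' := I) (t := (chartAt H x).source)
        γ_smooth.contMDiffOn uc
    calc
      edist (extChartAt I x y) (extChartAt I x z)
      _ = ‖γ' 1 - γ' 0‖ₑ := by
        rw [edist_comm, edist_eq_enorm_sub]; simp [γ', hγy, hγz]
      _ ≤ ∫⁻ t' in Icc 0 1, ‖derivWithin γ' (Icc 0 1) t'‖ₑ := by
        apply enorm_sub_le_lintegral_derivWithin_Icc_of_contDiffOn_Icc _ zero_le_one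
        rwa [← contMDiffOn_iff_contDiffOn]
      _ = ∫⁻ t' in Icc 0 1, ‖mfderiv[Icc 0 1] γ' t' 1‖ₑ := by
        simp_rw [← fderivWithin_derivWithin, mfderivWithin_eq_fderivWithin]
        rfl
      _ ≤ ∫⁻ t' in Icc 0 1, C * ‖mfderiv[Icc 0 1] γ t' 1‖ₑ := by
        apply setLIntegral_mono' measurableSet_Icc (fun t' ht' ↦ ?_)
        have : mfderiv[Icc 0 1] γ' t' =
            (mfderiv% (extChartAt I x) (γ t')) ∘L (mfderiv[Icc 0 1] γ t') := by
          apply mfderiv_comp_mfderivWithin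
          · exact mdifferentiableAt_extChartAt (uc t' ht')
          · exact (γ_smooth.mdifferentiable one_ne_zero).mdifferentiableOn _ ht'
          · rw [uniqueMDiffWithinAt_iff_uniqueDiffWithinAt]
            exact uniqueDiffOn_Icc zero_lt_one _ ht'
        have : mfderiv[Icc 0 1] γ' t' 1 =
            (mfderiv% (extChartAt I x) (γ t')) (mfderiv[Icc 0 1] γ t' 1) :=
          congr($this 1)
        rw [this]
        apply (ContinuousLinearMap.le_opENorm _ _).trans
        gcongr
        exact (hu t' ht').le
      _ = C * pathELength I γ 0 1 := by
        rw [lintegral_const_mul' _ _ ENNReal.coe_ne_top,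
            pathELength_eq_lintegral_mfderivWithin_Icc]
      _ ≤ C * r := by
        gcongr
  refine le_of_forall_gt fun b hb => ?_
  obtain ⟨r, hr1, hr2⟩ := exists_between
    (lt_min hyz ((ENNReal.lt_div_iff_mul_lt (Or.inl (by exact_mod_cast C_pos.ne'))
      (Or.inl ENNReal.coe_ne_top)).2 (by rwa [mul_comm])))
  refine (key r hr1 (hr2.trans_le (min_le_left _ _))).trans_lt ?_
  have := (ENNReal.lt_div_iff_mul_lt (Or.inl (by exact_mod_cast C_pos.ne'))
      (Or.inl ENNReal.coe_ne_top)).1 (hr2.trans_le (min_le_right _ _))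
  rwa [mul_comm]

end ChartEstimates

/-- Every point of `s` is the centre of a parametrization defined on the `r`-ball of `ℝᵐ` which is
`L`-bi-Lipschitz and covers the `r / L`-ball around the point. -/
def HasUniformCharts (m : ℕ) {M : Type*} [MetricSpace M] (L r : ℝ) (s : Set M) : Prop :=
  ∀ x ∈ s, ∃ ψ : EuclideanSpace ℝ (Fin m) → M, ψ 0 = x ∧
    (∀ u v, ‖u‖ < r → ‖v‖ < r →
      dist (ψ u) (ψ v) ≤ L * ‖u - v‖ ∧ ‖u - v‖ ≤ L * dist (ψ u) (ψ v)) ∧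
    ∀ y, L * dist x y < r → ∃ u, ‖u‖ < r ∧ ψ u = y

lemma HasUniformCharts.weaken {m : ℕ} {M : Type*} [MetricSpace M] {L r L' r' : ℝ} {s : Set M}
    (h : HasUniformCharts m L r s) (hL : L ≤ L') (hr' : 0 < r') (hr : r' ≤ r) :
    HasUniformCharts m L' r' s := by
  intro x hx
  obtain ⟨ψ, h0, hψ, hsurj⟩ := h x hx
  have mono : ∀ {d : ℝ}, 0 ≤ d → L * d ≤ L' * d :=
    fun hd => mul_le_mul_of_nonneg_right hL hd
  refine ⟨ψ, h0, fun u v hu hv => ?_, fun y hy => ?_⟩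
  · have := hψ u v (hu.trans_le hr) (hv.trans_le hr)
    exact ⟨this.1.trans (mono (norm_nonneg _)), this.2.trans (mono dist_nonneg)⟩
  · have hy' : L * dist x y < r' := (mono dist_nonneg).trans_lt hy
    obtain ⟨u, hu, rfl⟩ := hsurj y (hy'.trans_le hr)
    refine ⟨u, ?_, rfl⟩
    -- The preimage found in the larger ball lies in the smaller one by the lower bi-Lipschitz
    -- bound.
    have := (hψ u 0 hu (by simpa using hr'.trans_le hr)).2
    rw [h0, sub_zero, dist_comm] at this
    exact this.trans_lt hy'

section Charts
open Bundle Set Metric Manifold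
open scoped NNReal ENNReal Topology

/-- The inverse of the single chart at `x`, precomposed with a translation putting the image of `y`
at the origin, serves every nearby `y`. Halving both radii leaves room for the translation. -/
lemma exists_nhds_hasUniformCharts {m : ℕ} {M : Type*} [MetricSpace M]
    [ChartedSpace (EuclideanSpace ℝ (Fin m)) M]
    [IsManifold (𝓡 m) ∞ M] [RiemannianBundle (fun x : M => TangentSpace (𝓡 m) x)]
    [IsContMDiffRiemannianBundle (𝓡 m) ∞ (EuclideanSpace ℝ (Fin m))
      (fun x : M => TangentSpace (𝓡 m) x)]
    [IsRiemannianManifold (𝓡 m) M] (x : M) :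
    ∃ s ∈ 𝓝 x, ∃ L r : ℝ, 1 ≤ L ∧ 0 < r ∧ HasUniformCharts m L r s := by
  have : IsContinuousRiemannianBundle (EuclideanSpace ℝ (Fin m))
      (fun x : M => TangentSpace (𝓡 m) x) := by
    obtain ⟨g, hg, h⟩ := IsContMDiffRiemannianBundle.exists_contMDiff (IB := 𝓡 m) (n := ∞)
      (F := EuclideanSpace ℝ (Fin m)) (E := fun x : M => TangentSpace (𝓡 m) x)
    exact ⟨g, hg.continuous, h⟩
  have : IsManifold (𝓡 m) 1 M := IsManifold.of_le (n := ∞) (by simp)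
  obtain ⟨C₁, U₁, hU₁, h₁⟩ := exists_edist_le_edist_extChartAt (𝓡 m) x
  obtain ⟨C₂, U₂, hU₂, h₂⟩ := exists_edist_extChartAt_le_edist (𝓡 m) x
  set φ := extChartAt (𝓡 m) x with hφ
  obtain ⟨ε, ε_pos, hε⟩ := Metric.mem_nhds_iff.1
    (inter_mem (inter_mem hU₁ hU₂) (extChartAt_source_mem_nhds (I := 𝓡 m) x))
  obtain ⟨ρ, ρ_pos, hρ⟩ := Metric.mem_nhds_iff.1
    (inter_mem (extChartAt_target_mem_nhds (I := 𝓡 m) x)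
      (extChartAt_preimage_mem_nhds (I := 𝓡 m) (ball_mem_nhds x ε_pos)))
  have hbi : ∀ y ∈ ball x ε, ∀ z ∈ ball x ε,
      dist y z ≤ max 1 (max C₁ C₂ : ℝ) * ‖φ y - φ z‖ ∧
      ‖φ y - φ z‖ ≤ max 1 (max C₁ C₂ : ℝ) * dist y z := by
    intro y hy z hz
    have e1 := h₁ y (hε hy).1.1 z (hε hz).1.1
    have e2 := h₂ y (hε hy).1.2 z (hε hz).1.2
    rw [edist_nndist, edist_nndist, ← ENNReal.coe_mul, ENNReal.coe_le_coe,
      ← NNReal.coe_le_coe] at e1 e2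
    simp only [NNReal.coe_mul, coe_nndist] at e1 e2
    rw [← dist_eq_norm]
    constructor
    · refine e1.trans ?_
      gcongr
      simp
    · refine e2.trans ?_
      gcongr
      simp
  refine ⟨ball x (ε / 2) ∩ φ ⁻¹' ball (φ x) (ρ / 2), inter_mem (ball_mem_nhds _ (half_pos ε_pos))
    ((continuousAt_extChartAt x).preimage_mem_nhds (ball_mem_nhds _ (half_pos ρ_pos))),
    max 1 (max C₁ C₂ : ℝ), min (ε / 2) (ρ / 2), le_max_left _ _, by positivity, ?_⟩
  rintro y ⟨hy, hφy⟩
  have hyε : y ∈ ball x ε := ball_subset_ball (by linarith) hy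
  have hmem : ∀ u : EuclideanSpace ℝ (Fin m), ‖u‖ < min (ε / 2) (ρ / 2) →
      φ y + u ∈ ball (φ x) ρ := by
    intro u hu
    have h1 : dist (φ y) (φ x) < ρ / 2 := hφy
    have h2 := hu.trans_le (min_le_right _ _)
    rw [mem_ball, dist_eq_norm] at *
    calc ‖φ y + u - φ x‖ = ‖(φ y - φ x) + u‖ := by congr 1; abel
      _ ≤ _ := norm_add_le _ _
      _ < ρ := by linarith
  refine ⟨fun u => φ.symm (φ y + u), ?_, fun u v hu hv => ?_, fun z hz => ?_⟩
  · simp only [add_zero]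
    exact φ.left_inv (hε hyε).2
  · have hu' := hρ (hmem u hu)
    have hv' := hρ (hmem v hv)
    have := hbi _ hu'.2 _ hv'.2
    rw [φ.right_inv hu'.1, φ.right_inv hv'.1, add_sub_add_left_eq_sub] at this
    exact this
  · have hyz : dist y z < min (ε / 2) (ρ / 2) := by
      refine lt_of_le_of_lt ?_ hz
      exact le_mul_of_one_le_left dist_nonneg (le_max_left _ _)
    have hzε : z ∈ ball x ε := by
      have h1 : dist y x < ε / 2 := hy
      have h2 := hyz.trans_le (min_le_left _ _)
      have := dist_triangle_left z x y
      rw [mem_ball]; linarith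
    refine ⟨φ z - φ y, ?_, ?_⟩
    · rw [norm_sub_rev]
      exact (hbi y hyε z hzε).2.trans_lt hz
    · simp only [add_sub_cancel]
      exact φ.left_inv (hε hzε).2

theorem exists_hasUniformCharts (m : ℕ) (M : Type*) [MetricSpace M]
    [ChartedSpace (EuclideanSpace ℝ (Fin m)) M]
    [IsManifold (𝓡 m) ∞ M] [RiemannianBundle (fun x : M => TangentSpace (𝓡 m) x)]
    [IsContMDiffRiemannianBundle (𝓡 m) ∞ (EuclideanSpace ℝ (Fin m))
      (fun x : M => TangentSpace (𝓡 m) x)]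
    [IsRiemannianManifold (𝓡 m) M] [CompactSpace M] :
    ∃ L r : ℝ, 1 ≤ L ∧ 0 < r ∧ HasUniformCharts m L r (univ : Set M) := by
  refine isCompact_univ.induction_on
    (p := fun s : Set M => ∃ L r : ℝ, 1 ≤ L ∧ 0 < r ∧ HasUniformCharts m L r s) ?_ ?_ ?_ ?_
  · exact ⟨1, 1, le_rfl, one_pos, fun x hx => hx.elim⟩
  · rintro s t hst ⟨L, r, hL, hr, h⟩
    exact ⟨L, r, hL, hr, fun x hx => h x (hst hx)⟩
  · rintro s t ⟨L, r, hL, hr, h⟩ ⟨L', r', hL', hr', h'⟩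
    have hpos : 0 < min r r' := lt_min hr hr'
    refine ⟨max L L', min r r', hL.trans (le_max_left _ _), hpos, ?_⟩
    rintro x (hx | hx)
    · exact h.weaken (le_max_left _ _) hpos (min_le_left _ _) x hx
    · exact h'.weaken (le_max_right _ _) hpos (min_le_right _ _) x hx
  · intro x _
    obtain ⟨s, hs, h⟩ := exists_nhds_hasUniformCharts (m := m) x
    exact ⟨s, mem_nhdsWithin_of_mem_nhds hs, h⟩

end Charts

/-! ### Graph metrics and coarse maps between them -/

lemma IsMetric.nonneg {X : Type*} {d : X → X → ℝ} (h : IsMetric d) (x y : X) : 0 ≤ d x y := by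
  have := h.triangle x y x
  rw [h.self, h.symm y x] at this
  linarith

/-- A metric taking values in `ℕ` in which distinct points are joined by chains of unit steps, as
the path metric on the vertices of a connected graph. -/
structure IsGraphMetric {X : Type*} (d : X → X → ℝ) : Prop extends IsMetric d where
  exists_nat : ∀ x y, ∃ n : ℕ, d x y = n
  exists_step : ∀ x y, x ≠ y → ∃ z, d x z = 1 ∧ d z y = d x y - 1

/-- Sum the bound over a chain of unit steps. Since `e` needs neither symmetry nor separation, it
can be the pullback of a metric under any map, so Lipschitz estimates need only be checked on
neighbours. -/
lemma IsGraphMetric.le_mul {X : Type*} {d : X → X → ℝ} (hd : IsGraphMetric d) {e : X → X → ℝ}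
    (he₀ : ∀ x, e x x ≤ 0) (he : ∀ x y z, e x z ≤ e x y + e y z) {c : ℝ}
    (hc : ∀ x y, d x y = 1 → e x y ≤ c) (x y : X) : e x y ≤ c * d x y := by
  obtain ⟨n, hn⟩ := hd.exists_nat x y
  induction n generalizing x with
  | zero =>
    obtain rfl := hd.eq_of_eq_zero x y (by simpa using hn)
    simpa [hn] using he₀ x
  | succ n ih =>
    have hxy : x ≠ y := by
      rintro rfl
      rw [hd.self] at hn
      have : (0 : ℝ) ≤ n := n.cast_nonneg
      push_cast at hn
      linarith
    obtain ⟨z, hxz, hzy⟩ := hd.exists_step x y hxy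
    have h1 := ih z (by rw [hzy, hn]; push_cast; ring)
    have h2 := hc x z hxz
    have h3 := he x z y
    rw [hzy] at h1
    linarith

/-- Between graph metrics, coarse equivalences are quasi-isometries. -/
theorem quasiIsometric_of_coarse {X Y : Type*} {dX : X → X → ℝ} {dY : Y → Y → ℝ}
    (hX : IsGraphMetric dX) (hY : IsGraphMetric dY) (f : X → Y)
    (hf : ∀ r, ∃ r', ∀ x x', dX x x' ≤ r → dY (f x) (f x') ≤ r')
    (hf' : ∀ r, ∃ r', ∀ x x', dY (f x) (f x') ≤ r → dX x x' ≤ r')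
    (C : ℝ) (hC : ∀ y, ∃ x, dY y (f x) ≤ C) : QuasiIsometric dX dY := by
  choose g hg using hC
  obtain ⟨a, ha⟩ := hf 1
  -- For neighbours `y`, `y'` the images under `f` of their coarse preimages are at distance at most
  -- `C + 1 + C`, so the coarse inverse `g` is `b`-Lipschitz.
  obtain ⟨b, hb⟩ := hf' (1 + 2 * C)
  obtain ⟨c, hc⟩ := hf' C
  have hup : ∀ x x', dY (f x) (f x') ≤ a * dX x x' :=
    hX.le_mul (e := fun x x' => dY (f x) (f x')) (fun x => (hY.self _).le)
      (fun x y z => hY.triangle _ _ _) (fun x y h => ha x y h.le)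
  have hlow : ∀ y y', dX (g y) (g y') ≤ b * dY y y' := by
    refine hY.le_mul (e := fun y y' => dX (g y) (g y')) (fun x => (hX.self _).le)
      (fun x y z => hX.triangle _ _ _) (fun y y' h => hb _ _ ?_)
    have h1 := hY.triangle (f (g y)) y (f (g y'))
    have h2 := hY.triangle y y' (f (g y'))
    have h3 := hg y
    have h4 := hg y'
    rw [hY.symm] at h3
    linarith
  have hlow' : ∀ x x', dX x x' ≤ b * dY (f x) (f x') + 2 * c := by
    intro x x'
    have h1 := hc x (g (f x)) (hg (f x))
    have h2 := hc x' (g (f x')) (hg (f x'))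
    have h3 := hX.triangle x (g (f x)) x'
    have h4 := hX.triangle (g (f x)) (g (f x')) x'
    rw [hX.symm (g (f x')) x'] at h4
    have h5 := hlow (f x) (f x')
    linarith
  refine ⟨max 1 (max a b), max (max 0 (2 * c)) C, le_max_left _ _,
    (le_max_left _ _).trans (le_max_left _ _), f, fun x x' => ⟨?_, ?_⟩, fun y => ⟨g y, ?_⟩⟩
  · set L := max 1 (max a b) with hL
    have hL1 : 1 ≤ L := le_max_left _ _
    have hbL : b ≤ L := (le_max_right _ _).trans (le_max_right _ _)
    have h1 : dX x x' ≤ L * dY (f x) (f x') + L * max (max 0 (2 * c)) C := by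
      have h2 := mul_le_mul_of_nonneg_right hbL (hY.nonneg (f x) (f x'))
      have h3 : max (max 0 (2 * c)) C ≤ L * max (max 0 (2 * c)) C :=
        le_mul_of_one_le_left ((le_max_left _ _).trans (le_max_left _ _)) hL1
      have h4 : 2 * c ≤ max (max 0 (2 * c)) C := (le_max_right _ _).trans (le_max_left _ _)
      linarith [hlow' x x']
    have hL0 : 0 < L := by linarith
    rw [one_div, sub_le_iff_le_add, inv_mul_le_iff₀ hL0]
    linarith
  · have h1 : a ≤ max 1 (max a b) := (le_max_left _ _).trans (le_max_right _ _)
    have h2 := mul_le_mul_of_nonneg_right h1 (hX.nonneg x x')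
    have h3 : 0 ≤ max (max 0 (2 * c)) C := (le_max_left _ _).trans (le_max_left _ _)
    linarith [hup x x']
  · exact (hg y).trans (le_max_right _ _)

/-! ### Word metrics, their quotients and products with `ℤᵐ` -/

section WordMetric

variable {G : Type*} [Group G] {S : Set G}

lemma mulCayley_connected (hS : Subgroup.closure S = ⊤) : (SimpleGraph.mulCayley S).Connected := by
  have key : ∀ g : G, ∀ a, (SimpleGraph.mulCayley S).Reachable a (a * g) := by
    intro g
    have hg : g ∈ Subgroup.closure S := hS ▸ Subgroup.mem_top g
    induction hg using Subgroup.closure_induction with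
    | mem s hs =>
      intro a
      rcases eq_or_ne a (a * s) with h | h
      · rw [← h]
      · exact SimpleGraph.Adj.reachable (by
          rw [SimpleGraph.mulCayley_adj]
          exact ⟨h, Or.inl (by simpa using hs)⟩)
    | one => intro a; simp
    | mul x y _ _ hx hy =>
      intro a
      rw [← mul_assoc]
      exact (hx a).trans (hy _)
    | inv x _ hx =>
      intro a
      simpa using (hx (a * x⁻¹)).symm
  refine (SimpleGraph.connected_iff _).2 ⟨fun a b => ?_, ⟨1⟩⟩
  simpa using key (a⁻¹ * b) a

lemma isGraphMetric_wordDist (hS : Subgroup.closure S = ⊤) : IsGraphMetric (wordDist S) where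
  self x := by simp [wordDist]
  eq_of_eq_zero x y h := by
    simp only [wordDist, Nat.cast_eq_zero] at h
    exact (mulCayley_connected hS).dist_eq_zero_iff.1 h
  symm x y := by simp [wordDist, SimpleGraph.dist_comm]
  triangle x y z := by
    simp only [wordDist]
    exact_mod_cast (mulCayley_connected hS).dist_triangle
  exists_nat x y := ⟨_, rfl⟩
  exists_step x y hxy := by
    obtain ⟨p, hp⟩ := (mulCayley_connected hS).exists_walk_length_eq_dist x y
    cases p with
    | nil => exact absurd rfl hxy
    | @cons _ z _ h q =>
      refine ⟨z, ?_, ?_⟩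
      · simp [wordDist, SimpleGraph.dist_eq_one_iff_adj.2 h]
      · have h1 := SimpleGraph.dist_le q
        have h2 := (mulCayley_connected hS).dist_triangle (u := x) (v := z) (w := y)
        rw [SimpleGraph.dist_eq_one_iff_adj.2 h, ← hp] at h2
        simp only [SimpleGraph.Walk.length_cons] at h2 hp
        have h3 : (SimpleGraph.mulCayley S).dist z y = q.length := by omega
        simp [wordDist, ← hp, h3]

lemma wordDist_eq_one_iff (g h : G) :
    wordDist S g h = 1 ↔ g ≠ h ∧ (g⁻¹ * h ∈ S ∨ h⁻¹ * g ∈ S) := by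
  rw [← SimpleGraph.mulCayley_adj, ← SimpleGraph.dist_eq_one_iff_adj]
  simp [wordDist]

/-- Edges of the Cayley graph come from multiplication on the right, so left translations preserve
them. -/
lemma wordDist_mul_left (hS : Subgroup.closure S = ⊤) (a g h : G) :
    wordDist S (a * g) (a * h) = wordDist S g h := by
  have hd := isGraphMetric_wordDist hS
  have key : ∀ a g h, wordDist S (a * g) (a * h) ≤ wordDist S g h := by
    intro a g h
    have := hd.le_mul (e := fun g h => wordDist S (a * g) (a * h)) (c := 1)
      (fun x => (hd.self _).le) (fun x y z => hd.triangle _ _ _) (fun x y hxy => ?_) g h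
    · simpa using this
    · rw [wordDist_eq_one_iff] at hxy
      refine le_of_eq ((wordDist_eq_one_iff _ _).2 ⟨by simpa using hxy.1, ?_⟩)
      simpa [mul_assoc] using hxy.2
  refine le_antisymm (key a g h) ?_
  simpa using key a⁻¹ (a * g) (a * h)

lemma wordDist_one_mul_le (hS : Subgroup.closure S = ⊤) (g h : G) :
    wordDist S 1 (g * h) ≤ wordDist S 1 g + wordDist S 1 h := by
  have h1 := (isGraphMetric_wordDist hS).triangle 1 g (g * h)
  have h2 := wordDist_mul_left hS g 1 h
  rw [mul_one] at h2
  linarith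

lemma wordDist_one_inv (hS : Subgroup.closure S = ⊤) (g : G) :
    wordDist S 1 g⁻¹ = wordDist S 1 g := by
  have h := wordDist_mul_left hS g 1 g⁻¹
  rw [mul_one, mul_inv_cancel, (isGraphMetric_wordDist hS).symm] at h
  exact h.symm

lemma wordDist_one_inv_mul (hS : Subgroup.closure S = ⊤) (g h : G) :
    wordDist S 1 (g⁻¹ * h) = wordDist S g h := by
  have := wordDist_mul_left hS g 1 (g⁻¹ * h)
  rw [mul_one, mul_inv_cancel_left] at this
  exact this.symm

lemma finite_wordDist_ball (hS : Subgroup.closure S = ⊤) (hfin : S.Finite) (R : ℝ) :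
    {g : G | wordDist S 1 g ≤ R}.Finite := by
  -- The endpoints of a walk of length `n` differ by a product of `n` factors from `S ∪ S⁻¹`, which
  -- leaves finitely many possibilities.
  have key : ∀ n : ℕ, ∃ F : Set G, F.Finite ∧ ∀ u v : G, ∀ p : (SimpleGraph.mulCayley S).Walk u v,
      p.length = n → u⁻¹ * v ∈ F := by
    intro n
    induction n with
    | zero =>
      refine ⟨{1}, Set.finite_singleton _, fun u v p hp => ?_⟩
      obtain rfl := SimpleGraph.Walk.eq_of_length_eq_zero hp
      simp
    | succ n ih =>
      obtain ⟨F, hF, h⟩ := ih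
      refine ⟨Set.image2 (· * ·) (S ∪ S⁻¹) F, (hfin.union hfin.inv).image2 _ hF, fun u v p hp => ?_⟩
      cases p with
      | nil => simp at hp
      | @cons _ w _ hadj q =>
        refine ⟨u⁻¹ * w, ?_, w⁻¹ * v, h w v q (by simpa using hp), by simp [mul_assoc]⟩
        rw [SimpleGraph.mulCayley_adj] at hadj
        simpa using hadj.2
  choose F hF hFw using key
  refine ((Finset.range (⌊R⌋₊ + 1)).finite_toSet.biUnion (t := F) (fun n _ => hF n)).subset ?_
  intro g hg
  obtain ⟨p, hp⟩ := (mulCayley_connected hS).exists_walk_length_eq_dist 1 g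
  have : p.length ≤ ⌊R⌋₊ := by
    rw [hp]
    exact Nat.le_floor hg
  simp only [Set.mem_iUnion]
  refine ⟨p.length, by simpa using Nat.lt_succ_of_le this, ?_⟩
  simpa using hFw _ 1 g p rfl

end WordMetric

section Quotient

variable {G : Type*} [Group G] {S : Set G} (K : Subgroup G) [K.Normal]

lemma closure_image_mk' (hS : Subgroup.closure S = ⊤) :
    Subgroup.closure (QuotientGroup.mk' K '' S) = ⊤ := by
  rw [← MonoidHom.map_closure, hS, ← MonoidHom.range_eq_map,
    MonoidHom.range_eq_top.2 (QuotientGroup.mk'_surjective K)]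

lemma wordDist_mk'_le (hS : Subgroup.closure S = ⊤) (g h : G) :
    wordDist (QuotientGroup.mk' K '' S) (QuotientGroup.mk' K g) (QuotientGroup.mk' K h) ≤
      wordDist S g h := by
  have hd := isGraphMetric_wordDist (closure_image_mk' K hS)
  have := (isGraphMetric_wordDist hS).le_mul (c := 1)
    (e := fun g h => wordDist (QuotientGroup.mk' K '' S) (QuotientGroup.mk' K g)
      (QuotientGroup.mk' K h))
    (fun x => (hd.self _).le) (fun x y z => hd.triangle _ _ _) (fun x y hxy => ?_) g h
  · simpa using this
  · rw [wordDist_eq_one_iff] at hxy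
    rcases eq_or_ne (QuotientGroup.mk' K x) (QuotientGroup.mk' K y) with he | he
    · rw [he, hd.self]
      exact zero_le_one
    · refine le_of_eq ((wordDist_eq_one_iff _ _).2 ⟨he, ?_⟩)
      rw [← map_inv, ← map_inv, ← map_mul, ← map_mul]
      exact hxy.2.imp (Set.mem_image_of_mem _) (Set.mem_image_of_mem _)

/-- A geodesic in the quotient Cayley graph lifts edge by edge to a word in `S` of no greater
length. -/
lemma exists_lift_wordDist_le (hS : Subgroup.closure S = ⊤) (g h : G ⧸ K) :
    ∃ a : G, g * QuotientGroup.mk' K a = h ∧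
      wordDist S 1 a ≤ wordDist (QuotientGroup.mk' K '' S) g h := by
  obtain ⟨p, hp⟩ := (mulCayley_connected (closure_image_mk' K hS)).exists_walk_length_eq_dist g h
  simp only [wordDist, ← hp]
  clear hp
  induction p with
  | nil => exact ⟨1, by simp, by simp⟩
  | @cons u w v hadj q ih =>
    obtain ⟨a, ha, hle⟩ := ih
    rw [SimpleGraph.mulCayley_adj] at hadj
    obtain ⟨b, hb, hble⟩ : ∃ b : G, u * QuotientGroup.mk' K b = w ∧ wordDist S 1 b ≤ 1 := by
      rcases hadj.2 with ⟨s, hs, h⟩ | ⟨s, hs, h⟩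
      · refine ⟨s, by rw [h]; simp, ?_⟩
        rcases eq_or_ne 1 s with rfl | h1
        · simp [wordDist]
        · exact le_of_eq ((wordDist_eq_one_iff _ _).2 ⟨h1, Or.inl (by simpa using hs)⟩)
      · refine ⟨s⁻¹, by rw [map_inv, h]; simp, ?_⟩
        rcases eq_or_ne 1 s with rfl | h1
        · simp [wordDist]
        · exact le_of_eq ((wordDist_eq_one_iff _ _).2
            ⟨by simpa [eq_comm] using h1, Or.inr (by simpa using hs)⟩)
    refine ⟨b * a, by rw [map_mul, ← mul_assoc, hb, ha], ?_⟩
    have := wordDist_one_mul_le hS b a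
    simp only [wordDist, SimpleGraph.Walk.length_cons, Nat.cast_add, Nat.cast_one] at *
    linarith

end Quotient

section ProdInt

variable {G : Type*} [Group G] {S : Set G}

lemma isGraphMetric_prodIntDist (hS : Subgroup.closure S = ⊤) (m : ℕ) :
    IsGraphMetric (prodIntDist S m) where
  self x := by simp [prodIntDist, (isGraphMetric_wordDist hS).self]
  eq_of_eq_zero x y h := by
    have h1 := (isGraphMetric_wordDist hS).nonneg x.1 y.1
    have h2 : 0 ≤ ∑ i, |(x.2 i : ℝ) - (y.2 i : ℝ)| := Finset.sum_nonneg fun i _ => abs_nonneg _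
    simp only [prodIntDist] at h
    have h3 : ∑ i, |(x.2 i : ℝ) - (y.2 i : ℝ)| = 0 := by linarith
    rw [Finset.sum_eq_zero_iff_of_nonneg fun i _ => abs_nonneg _] at h3
    refine Prod.ext ((isGraphMetric_wordDist hS).eq_of_eq_zero _ _ (by linarith)) ?_
    funext i
    have := h3 i (Finset.mem_univ i)
    rw [abs_eq_zero, sub_eq_zero] at this
    exact_mod_cast this
  symm x y := by
    simp only [prodIntDist, (isGraphMetric_wordDist hS).symm x.1 y.1, abs_sub_comm]
  triangle x y z := by
    have h1 := (isGraphMetric_wordDist hS).triangle x.1 y.1 z.1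
    have h2 : ∑ i, |(x.2 i : ℝ) - (z.2 i : ℝ)| ≤
        ∑ i, |(x.2 i : ℝ) - (y.2 i : ℝ)| + ∑ i, |(y.2 i : ℝ) - (z.2 i : ℝ)| := by
      rw [← Finset.sum_add_distrib]
      exact Finset.sum_le_sum fun i _ => abs_sub_le _ _ _
    simp only [prodIntDist]
    linarith
  exists_nat x y := by
    obtain ⟨n, hn⟩ := (isGraphMetric_wordDist hS).exists_nat x.1 y.1
    refine ⟨n + ∑ i, (x.2 i - y.2 i).natAbs, ?_⟩
    simp [prodIntDist, hn, Nat.cast_natAbs]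
  exists_step x y hxy := by
    rcases eq_or_ne x.1 y.1 with h1 | h1
    · have h2 : x.2 ≠ y.2 := fun h => hxy (Prod.ext h1 h)
      obtain ⟨i, hi⟩ := Function.ne_iff.1 h2
      obtain ⟨e, he, he'⟩ : ∃ e : ℤ, |(e : ℝ) - x.2 i| = 1 ∧
          |(e : ℝ) - y.2 i| = |(x.2 i : ℝ) - y.2 i| - 1 := by
        rcases lt_or_gt_of_ne hi with h | h
        · have : (x.2 i : ℝ) + 1 ≤ y.2 i := by exact_mod_cast h
          refine ⟨x.2 i + 1, by simp, ?_⟩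
          push_cast
          rw [abs_of_nonpos (by linarith), abs_of_nonpos (by linarith)]
          ring
        · have : (y.2 i : ℝ) + 1 ≤ x.2 i := by exact_mod_cast h
          refine ⟨x.2 i - 1, by simp, ?_⟩
          push_cast
          rw [abs_of_nonneg (by linarith), abs_of_nonneg (by linarith)]
          ring
      refine ⟨(x.1, Function.update x.2 i e), ?_, ?_⟩
      · simp only [prodIntDist, (isGraphMetric_wordDist hS).self, zero_add]
        rw [Finset.sum_eq_single i]
        · simpa [abs_sub_comm] using he
        · intro j _ hj
          simp [Function.update_of_ne hj]
        · simp
      · simp only [prodIntDist]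
        rw [← Finset.add_sum_erase _ _ (Finset.mem_univ i),
          ← Finset.add_sum_erase _ (fun i => |(x.2 i : ℝ) - (y.2 i : ℝ)|) (Finset.mem_univ i)]
        rw [Finset.sum_congr rfl (g := fun j => |(x.2 j : ℝ) - (y.2 j : ℝ)|)]
        · simp only [Function.update_self, he']
          ring
        · intro j hj
          rw [Function.update_of_ne (Finset.ne_of_mem_erase hj)]
    · obtain ⟨z, hz, hz'⟩ := (isGraphMetric_wordDist hS).exists_step x.1 y.1 h1
      refine ⟨(z, x.2), by simp [prodIntDist, hz], ?_⟩
      simp only [prodIntDist, hz']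
      ring

lemma finite_prodIntDist_ball (hS : Subgroup.closure S = ⊤) (hfin : S.Finite) (m : ℕ) (R : ℝ) :
    {p : G × (Fin m → ℤ) | prodIntDist S m (1, 0) p ≤ R}.Finite := by
  refine ((finite_wordDist_ball hS hfin R).prod
    (Set.Finite.pi' (t := fun _ : Fin m => Set.Icc (-⌈R⌉) ⌈R⌉)
      fun _ => Set.finite_Icc _ _)).subset ?_
  rintro ⟨g, v⟩ h
  simp only [Set.mem_ofPred_eq, prodIntDist, Pi.zero_apply, Int.cast_zero, zero_sub, abs_neg] at h
  have h1 := (isGraphMetric_wordDist hS).nonneg 1 g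
  have h2 : 0 ≤ ∑ i, |(v i : ℝ)| := Finset.sum_nonneg fun i _ => abs_nonneg _
  refine ⟨by simp only [Set.mem_ofPred_eq]; linarith, fun i => ?_⟩
  have h3 : |(v i : ℝ)| ≤ R :=
    (Finset.single_le_sum (f := fun i => |(v i : ℝ)|) (fun i _ => abs_nonneg _)
      (Finset.mem_univ i)).trans (by linarith)
  rw [Set.mem_Icc, ← abs_le]
  have h4 : |(v i : ℝ)| ≤ ⌈R⌉ := h3.trans (Int.le_ceil R)
  exact_mod_cast h4

end ProdInt

/-! ### Local models and passage to the limit -/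

/-- Up to quasi-isometry with constants `L`, `A`, the `R`-ball around `x₀` in `(X, dX)` looks like
a ball around `p₀` in `(P, dP)`. -/
def IsLocalModel {P X : Type*} (dP : P → P → ℝ) (p₀ : P) (dX : X → X → ℝ) (x₀ : X)
    (L A R : ℝ) : Prop :=
  ∃ Φ : P → X, dX x₀ (Φ p₀) ≤ A ∧
    (∀ p q, dP p₀ p ≤ R → dP p₀ q ≤ R →
      dX (Φ p) (Φ q) ≤ L * dP p q + A ∧ dP p q ≤ L * dX (Φ p) (Φ q) + A) ∧
    ∀ y, dX x₀ y ≤ R → ∃ p, dP p₀ p ≤ L * dX x₀ y + A ∧ dX y (Φ p) ≤ A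

lemma IsLocalModel.weaken {P X : Type*} {dP : P → P → ℝ} {p₀ : P} {dX : X → X → ℝ} {x₀ : X}
    {L A R L' A' : ℝ} (hP : IsMetric dP) (hX : IsMetric dX) (h : IsLocalModel dP p₀ dX x₀ L A R)
    (hL : L ≤ L') (hA : A ≤ A') : IsLocalModel dP p₀ dX x₀ L' A' R := by
  obtain ⟨Φ, h0, hΦ, hs⟩ := h
  refine ⟨Φ, h0.trans hA, fun p q hp hq => ?_, fun y hy => ?_⟩
  · have h1 := mul_le_mul_of_nonneg_right hL (hP.nonneg p q)
    have h2 := mul_le_mul_of_nonneg_right hL (hX.nonneg (Φ p) (Φ q))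
    have h3 := hΦ p q hp hq
    constructor <;> linarith
  · obtain ⟨p, hp, hyp⟩ := hs y hy
    have h1 := mul_le_mul_of_nonneg_right hL (hX.nonneg x₀ y)
    exact ⟨p, by linarith, hyp.trans hA⟩

/-- Uniform coarse equivalences between spaces which look, on larger and larger balls, like proper
graph metrics induce in the limit a quasi-isometry between these. -/
theorem quasiIsometric_of_localModels {P Q : Type*} {dP : P → P → ℝ} {dQ : Q → Q → ℝ}
    (hP : IsGraphMetric dP) (hQ : IsGraphMetric dQ) {p₀ : P} {q₀ : Q}
    (hPfin : ∀ R, {p | dP p₀ p ≤ R}.Finite) (hQfin : ∀ R, {q | dQ q₀ q ≤ R}.Finite)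
    {X Y : ℕ → Type*} {dX : ∀ k, X k → X k → ℝ} {dY : ∀ k, Y k → Y k → ℝ}
    (hdX : ∀ k, IsMetric (dX k)) (hdY : ∀ k, IsMetric (dY k))
    {x : ∀ k, X k} {y : ∀ k, Y k} {L A : ℝ} (hL : 0 ≤ L) {R : ℕ → ℝ} (hR : Tendsto R atTop atTop)
    (hX : ∀ k, IsLocalModel dP p₀ (dX k) (x k) L A (R k))
    (hY : ∀ k, IsLocalModel dQ q₀ (dY k) (y k) L A (R k)) {f : ∀ k, X k → Y k}
    (hup : ∀ r, ∃ r', ∀ k a b, dX k a b ≤ r → dY k (f k a) (f k b) ≤ r')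
    (hlow : ∀ r, ∃ r', ∀ k a b, dY k (f k a) (f k b) ≤ r → dX k a b ≤ r')
    {C : ℝ} (hC : ∀ k b, ∃ a, dY k b (f k a) ≤ C) (hbase : ∀ k, dY k (y k) (f k (x k)) ≤ C) :
    QuasiIsometric dP dQ := by
  choose Φ hΦ0 hΦ hΦs using hX
  choose Ψ hΨ0 hΨ hΨs using hY
  -- Along an ultrafilter, a choice among finitely many elements which depends on `k` is constant on
  -- a large set; this replaces diagonal extraction of subsequences.
  let U : Ultrafilter ℕ := hyperfilter ℕ
  have hRU : ∀ r, ∀ᶠ k in (U : Filter ℕ), r ≤ R k := by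
    intro r
    have : Tendsto R (U : Filter ℕ) atTop :=
      hR.mono_left ((Filter.hyperfilter_le_cofinite (α := ℕ)).trans Nat.cofinite_eq_atTop.le)
    exact this.eventually_ge_atTop r
  have hΦbd : ∀ p, ∀ᶠ k in (U : Filter ℕ), dX k (x k) (Φ k p) ≤ A + (L * dP p₀ p + A) := by
    intro p
    filter_upwards [hRU 0, hRU (dP p₀ p)] with k h0 h1
    have h2 := (hΦ k p₀ p (by rwa [hP.self]) h1).1
    have h3 := (hdX k).triangle (x k) (Φ k p₀) (Φ k p)
    linarith [hΦ0 k]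
  have hΨbd : ∀ q, ∀ᶠ k in (U : Filter ℕ), dY k (y k) (Ψ k q) ≤ A + (L * dQ q₀ q + A) := by
    intro q
    filter_upwards [hRU 0, hRU (dQ q₀ q)] with k h0 h1
    have h2 := (hΨ k q₀ q (by rwa [hQ.self]) h1).1
    have h3 := (hdY k).triangle (y k) (Ψ k q₀) (Ψ k q)
    linarith [hΨ0 k]
  -- The image of `Φ k p` stays at bounded distance from the base point, so the `q` modelling it
  -- ranges over a fixed finite ball.
  have hF : ∀ p, ∃ q, ∀ᶠ k in (U : Filter ℕ), dY k (f k (Φ k p)) (Ψ k q) ≤ A := by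
    intro p
    obtain ⟨r, hr⟩ := hup (A + (L * dP p₀ p + A))
    have : ∀ᶠ k in (U : Filter ℕ), ∃ q ∈ {q | dQ q₀ q ≤ L * (C + r) + A},
        dY k (f k (Φ k p)) (Ψ k q) ≤ A := by
      filter_upwards [hΦbd p, hRU (C + r)] with k h1 h2
      have h3 := (hdY k).triangle (y k) (f k (x k)) (f k (Φ k p))
      have h4 := hr k _ _ h1
      have h5 : dY k (y k) (f k (Φ k p)) ≤ C + r := by linarith [hbase k]
      obtain ⟨q, hq, hq'⟩ := hΨs k _ (h5.trans h2)
      refine ⟨q, hq.trans ?_, hq'⟩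
      have := mul_le_mul_of_nonneg_left h5 hL
      linarith
    obtain ⟨q, -, hq⟩ := (Ultrafilter.eventually_exists_mem_iff (hQfin _)).1 this
    exact ⟨q, hq⟩
  choose F hF using hF
  obtain ⟨s, hs⟩ := hup A
  refine quasiIsometric_of_coarse hP hQ F (fun r => ?_) (fun r => ?_)
    (L * (C + s + A) + A) (fun q => ?_)
  · obtain ⟨r', hr'⟩ := hup (L * r + A)
    refine ⟨L * (A + r' + A) + A, fun p p' hpp => ?_⟩
    -- Distances in `P` and `Q` do not involve `k` and the bounds are uniform, so one `k` good for
    -- both points is enough.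
    obtain ⟨k, h1, h2, h3, h4, h5, h6⟩ := ((hF p).and ((hF p').and ((hRU (dP p₀ p)).and
      ((hRU (dP p₀ p')).and ((hRU (dQ q₀ (F p))).and (hRU (dQ q₀ (F p')))))))).exists
    have h7 := (hΦ k p p' h3 h4).1
    have h8 := mul_le_mul_of_nonneg_left hpp hL
    have h9 := hr' k (Φ k p) (Φ k p') (by linarith)
    have h10 := (hΨ k (F p) (F p') h5 h6).2
    have h11 := (hdY k).triangle (Ψ k (F p)) (f k (Φ k p)) (Ψ k (F p'))
    have h12 := (hdY k).triangle (f k (Φ k p)) (f k (Φ k p')) (Ψ k (F p'))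
    rw [(hdY k).symm] at h1
    have h13 : dY k (Ψ k (F p)) (Ψ k (F p')) ≤ A + r' + A := by linarith
    have := mul_le_mul_of_nonneg_left h13 hL
    linarith
  · obtain ⟨r', hr'⟩ := hlow (A + (L * r + A) + A)
    refine ⟨L * r' + A, fun p p' hpp => ?_⟩
    obtain ⟨k, h1, h2, h3, h4, h5, h6⟩ := ((hF p).and ((hF p').and ((hRU (dP p₀ p)).and
      ((hRU (dP p₀ p')).and ((hRU (dQ q₀ (F p))).and (hRU (dQ q₀ (F p')))))))).exists
    have h7 := (hΨ k (F p) (F p') h5 h6).1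
    have h8 := mul_le_mul_of_nonneg_left hpp hL
    have h11 := (hdY k).triangle (f k (Φ k p)) (Ψ k (F p)) (f k (Φ k p'))
    have h12 := (hdY k).triangle (Ψ k (F p)) (Ψ k (F p')) (f k (Φ k p'))
    rw [(hdY k).symm] at h2
    have h9 := hr' k (Φ k p) (Φ k p') (by linarith)
    have h10 := (hΦ k p p' h3 h4).2
    have := mul_le_mul_of_nonneg_left h9 hL
    linarith
  -- Coarse density: a coarse preimage of `Ψ k q` lies within `r'` of `x k` by the lower control, so
  -- it is seen by the model of `X k`, and again the modelling point `p` can be fixed along `U`.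
  · obtain ⟨r', hr'⟩ := hlow (C + (A + (L * dQ q₀ q + A)) + C)
    have : ∀ᶠ k in (U : Filter ℕ), ∃ p ∈ {p | dP p₀ p ≤ L * r' + A},
        dY k (Ψ k q) (f k (Φ k p)) ≤ C + s := by
      filter_upwards [hΨbd q, hRU r'] with k h1 h2
      obtain ⟨a, ha⟩ := hC k (Ψ k q)
      have h3 := (hdY k).triangle (f k (x k)) (y k) (f k a)
      have h4 := (hdY k).triangle (y k) (Ψ k q) (f k a)
      have h5 := hbase k
      rw [(hdY k).symm] at h5
      have h6 := hr' k (x k) a (by linarith)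
      obtain ⟨p, hp, hp'⟩ := hΦs k a (h6.trans h2)
      refine ⟨p, hp.trans ?_, ?_⟩
      · have := mul_le_mul_of_nonneg_left h6 hL
        linarith
      · have h7 := hs k _ _ hp'
        have h8 := (hdY k).triangle (Ψ k q) (f k a) (f k (Φ k p))
        linarith
    obtain ⟨p, -, hp⟩ := (Ultrafilter.eventually_exists_mem_iff (hPfin _)).1 this
    refine ⟨p, ?_⟩
    obtain ⟨k, h1, h2, h3, h4⟩ := ((hF p).and (hp.and ((hRU (dQ q₀ q)).and
      (hRU (dQ q₀ (F p)))))).exists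
    have h5 := (hΨ k q (F p) h3 h4).2
    have h6 := (hdY k).triangle (Ψ k q) (f k (Φ k p)) (Ψ k (F p))
    have h7 : dY k (Ψ k q) (Ψ k (F p)) ≤ C + s + A := by linarith
    have := mul_le_mul_of_nonneg_left h7 hL
    linarith

lemma IsControlFunction.exists_le_of_le {ρ : ℝ → ℝ} (h : IsControlFunction ρ) (r : ℝ) :
    ∃ r', ∀ s, ρ s ≤ r → s ≤ r' := by
  obtain ⟨r', hr'⟩ := eventually_atTop.1 (h.unbounded.eventually_gt_atTop r)
  refine ⟨r', fun _ hs => ?_⟩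
  by_contra! hlt
  exact (hr' _ hlt.le).not_ge hs

lemma IsControlFunction.exists_apply_le {ρ : ℝ → ℝ} (h : IsControlFunction ρ) (r : ℝ) :
    ∃ r', ∀ s, 0 ≤ s → s ≤ r → ρ s ≤ r' :=
  ⟨ρ (max r 0), fun _ hs hsr => h.mono hs (show (0 : ℝ) ≤ max r 0 from le_max_right _ _) (hsr.trans (le_max_left _ _))⟩
/-- Maps realizing a uniform coarse equivalence, with the control functions unpacked. -/
lemma UniformlyCoarselyEquivalent.exists_maps {X Y : ℕ → Type*} {dX : ∀ k, X k → X k → ℝ}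
    {dY : ∀ k, Y k → Y k → ℝ} (hdX : ∀ k, IsMetric (dX k))
    (h : UniformlyCoarselyEquivalent dX dY) :
    ∃ f : ∀ k, X k → Y k,
      (∀ r, ∃ r', ∀ k a b, dX k a b ≤ r → dY k (f k a) (f k b) ≤ r') ∧
      (∀ r, ∃ r', ∀ k a b, dY k (f k a) (f k b) ≤ r → dX k a b ≤ r') ∧
      ∃ C, 0 < C ∧ ∀ k b, ∃ a, dY k b (f k a) ≤ C := by
  obtain ⟨ρ₁, ρ₂, h₁, h₂, C, hC, hf⟩ := h
  choose f hf hfC using hf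
  refine ⟨f, fun r => ?_, fun r => ?_, C, hC, hfC⟩
  · obtain ⟨r', hr'⟩ := h₂.exists_apply_le r
    exact ⟨r', fun k a b hab => (hf k a b).2.trans (hr' _ ((hdX k).nonneg a b) hab)⟩
  · obtain ⟨r', hr'⟩ := h₁.exists_le_of_le r
    exact ⟨r', fun k a b hab => hr' _ ((hf k a b).1.trans hab)⟩

/-- Elements `g`, `h` of the `R`-ball differ by a word of length at most `2 * R`, and so does the
shortest lift `a` between their classes. Then `a⁻¹ * (g⁻¹ * h)` lies in `K` with length at most `4 *
R`, hence is trivial, and the quotient map is isometric on the ball. -/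
lemma isLocalModel_quotient {G : Type*} [Group G] {S : Set G} (hS : Subgroup.closure S = ⊤)
    (K : Subgroup G) [K.Normal] {R : ℝ} (hK : ∀ g ∈ K, wordDist S 1 g ≤ 4 * R → g = 1)
    (x : G ⧸ K) :
    IsLocalModel (wordDist S) 1 (wordDist (QuotientGroup.mk' K '' S)) x 1 0 R := by
  have hS' := closure_image_mk' K hS
  have hd := isGraphMetric_wordDist hS
  have hd' := isGraphMetric_wordDist hS'
  refine ⟨fun g => x * QuotientGroup.mk' K g, by simp only [map_one, mul_one, hd'.self, le_refl], fun g h hg hh => ?_,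
    fun y _ => ?_⟩
  · rw [wordDist_mul_left hS']
    have hle := wordDist_mk'_le K hS g h
    refine ⟨by linarith, ?_⟩
    obtain ⟨a, ha, hle'⟩ := exists_lift_wordDist_le K hS (QuotientGroup.mk' K g)
      (QuotientGroup.mk' K h)
    have hgh : wordDist S g h ≤ 2 * R := by
      have := hd.triangle g 1 h
      rw [hd.symm g 1] at this
      linarith
    have h1 : (g * a)⁻¹ * h = 1 := by
      refine hK _ ?_ ?_
      · rw [← QuotientGroup.eq]
        exact ha
      · have h2 : (g * a)⁻¹ * h = a⁻¹ * (g⁻¹ * h) := by group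
        have h3 := wordDist_one_mul_le hS a⁻¹ (g⁻¹ * h)
        rw [wordDist_one_inv hS, wordDist_one_inv_mul hS g h] at h3
        rw [h2]
        linarith
    have h2 : a = g⁻¹ * h := by
      rw [inv_mul_eq_one] at h1
      rw [← h1]; simp
    rw [h2, wordDist_one_inv_mul hS] at hle'
    linarith
  · obtain ⟨a, rfl, hle⟩ := exists_lift_wordDist_le K hS x y
    exact ⟨a, by linarith, (hd'.self _).le⟩

lemma eventually_inter_ball_trivial {G : Type*} [Group G] {S : Set G}
    (hS : Subgroup.closure S = ⊤) (hfin : S.Finite) {K : ℕ → Subgroup G}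
    (hK : ∀ k, K (k + 1) ≤ K k) (hbot : ⨅ k, K k = ⊥) (R : ℝ) :
    ∀ᶠ k in atTop, ∀ g ∈ K k, wordDist S 1 g ≤ R → g = 1 := by
  have hanti : Antitone K := antitone_nat_of_succ_le hK
  have : ∀ g ∈ {g : G | wordDist S 1 g ≤ R}, ∀ᶠ k in atTop, g ∈ K k → g = 1 := by
    intro g _
    by_cases hg : g = 1
    · exact Eventually.of_forall fun _ _ => hg
    · have : g ∉ ⨅ k, K k := by rw [hbot]; simpa using hg
      obtain ⟨n, hn⟩ : ∃ n, g ∉ K n := by simpa [Subgroup.mem_iInf] using this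
      filter_upwards [eventually_ge_atTop n] with k hk hgk
      exact absurd (hanti hk hgk) hn
  filter_upwards [(eventually_all_finite (finite_wordDist_ball hS hfin R)).2 this] with k hk g hg hgR
  exact hk g hgR hg

/-! ### Local structure of warped cones over isometric actions -/

section Warped

variable {G : Type*} [Group G] {S : Set G} {X : Type*} [MetricSpace X] [MulAction G X] {t : ℝ}

lemma isMetric_warpedDist (ht : 0 < t) : IsMetric (warpedDist S t : X → X → ℝ) :=
  (warpedDist_isGreatest S t ht).1.1

lemma warpedDist_smul_le (hS : Subgroup.closure S = ⊤) (ht : 0 < t) (g : G) (x : X) :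
    warpedDist S t x (g • x) ≤ wordDist S 1 g := by
  have hw := (warpedDist_isGreatest (X := X) S t ht).1
  -- Inverses turn right multiplication by a generator, the Cayley edge, into the left action that
  -- is warped.
  have := (isGraphMetric_wordDist hS).le_mul (c := 1)
    (e := fun g h => warpedDist S t (g⁻¹ • x) (h⁻¹ • x))
    (fun x => (hw.1.self _).le) (fun x y z => hw.1.triangle _ _ _) (fun a b hab => ?_) 1 g⁻¹
  · simpa [wordDist_one_inv hS] using this
  · rw [wordDist_eq_one_iff] at hab
    rcases hab.2 with h | h
    · rw [hw.1.symm]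
      have := hw.2.2 _ h (b⁻¹ • x)
      rwa [smul_smul, mul_assoc, mul_inv_cancel, mul_one] at this
    · have := hw.2.2 _ h (a⁻¹ • x)
      rwa [smul_smul, mul_assoc, mul_inv_cancel, mul_one] at this

lemma warpedDist_le (hS : Subgroup.closure S = ⊤) (ht : 0 < t) (g : G) (x y : X) :
    warpedDist S t x y ≤ wordDist S 1 g + t * dist (g • x) y := by
  have hw := (warpedDist_isGreatest (X := X) S t ht).1
  linarith [hw.1.triangle x (g • x) y, hw.2.1 (g • x) y, warpedDist_smul_le hS ht g x]

/-- For an isometric action the warped distance is the infimum of the costs of a single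
group translation followed by a single move. -/
lemma exists_le_warpedDist_add [IsIsometricSMul G X] (hS : Subgroup.closure S = ⊤) (ht : 0 < t)
    (x y : X) {ε : ℝ} (hε : 0 < ε) :
    ∃ g : G, wordDist S 1 g + t * dist (g • x) y ≤ warpedDist S t x y + ε := by
  have hd := isGraphMetric_wordDist hS
  -- As the warped distance is the largest admissible metric, it suffices that this infimum is
  -- itself admissible.
  let D : X → X → ℝ := fun x y => ⨅ g : G, (wordDist S 1 g + t * dist (g • x) y)
  have hnn : ∀ (x y : X) (g : G), 0 ≤ wordDist S 1 g + t * dist (g • x) y := fun x y g =>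
    add_nonneg (hd.nonneg _ _) (mul_nonneg ht.le dist_nonneg)
  have hbdd : ∀ x y : X, BddBelow (Set.range fun g : G => wordDist S 1 g + t * dist (g • x) y) := by
    intro x y
    refine ⟨0, ?_⟩
    rintro _ ⟨g, rfl⟩
    exact hnn x y g
  have hle : ∀ (x y : X) (g : G), D x y ≤ wordDist S 1 g + t * dist (g • x) y :=
    fun x y g => ciInf_le (hbdd x y) g
  have hex : ∀ (x y : X) {ε : ℝ}, 0 < ε →
      ∃ g : G, wordDist S 1 g + t * dist (g • x) y < D x y + ε :=
    fun x y ε hε => exists_lt_of_ciInf_lt (lt_add_of_pos_right _ hε)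
  have hself : ∀ x, D x x = 0 := fun x =>
    le_antisymm (by simpa [hd.self] using hle x x 1) (le_ciInf fun g => hnn x x g)
  have hsymm : ∀ x y, D x y ≤ D y x := by
    refine fun x y => le_ciInf fun g => ?_
    have := hle x y g⁻¹
    rw [wordDist_one_inv hS] at this
    rwa [← dist_smul g, smul_inv_smul, dist_comm] at this
  have hD : D ∈ warpedMetrics S t := by
    refine ⟨⟨hself, fun x y h => ?_, fun x y => le_antisymm (hsymm x y) (hsymm y x),
      fun x y z => ?_⟩, fun x y => ?_, fun s hs x => ?_⟩
    · by_contra hne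
      -- Word lengths are integers, so a cost below `1` forces `g = 1`, and then the cost is `t *
      -- dist x y`.
      have hpos : 0 < min (t * dist x y) 1 := lt_min (mul_pos ht (dist_pos.2 hne)) one_pos
      obtain ⟨g, hg⟩ := hex x y hpos
      rw [h, zero_add] at hg
      have h1 : wordDist S 1 g < 1 := by
        have : 0 ≤ t * dist (g • x) y := mul_nonneg ht.le dist_nonneg
        linarith [min_le_right (t * dist x y) 1]
      obtain ⟨n, hn⟩ := hd.exists_nat 1 g
      have h2 : n = 0 := by
        rw [hn] at h1
        exact Nat.lt_one_iff.1 (by exact_mod_cast h1)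
      have h3 : (1 : G) = g := hd.eq_of_eq_zero _ _ (by rw [hn, h2, Nat.cast_zero])
      rw [← h3, hd.self, one_smul, zero_add] at hg
      exact (hg.trans_le (min_le_left _ _)).false
    · refine le_of_forall_pos_le_add fun ε hε => ?_
      obtain ⟨g, hg⟩ := hex x y (half_pos hε)
      obtain ⟨h, hh⟩ := hex y z (half_pos hε)
      have h1 := hle x z (h * g)
      have h2 := wordDist_one_mul_le hS h g
      have h3 := dist_triangle ((h * g) • x) (h • y) z
      rw [mul_smul, dist_smul] at h3
      rw [mul_smul] at h1
      have h4 := mul_le_mul_of_nonneg_left h3 ht.le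
      linarith
    · simpa [hd.self] using hle x y 1
    · have h1 := hle x (s • x) s
      rw [dist_self, mul_zero, add_zero] at h1
      refine h1.trans ?_
      rcases eq_or_ne 1 s with rfl | hs1
      · rw [hd.self]; exact zero_le_one
      · exact le_of_eq ((wordDist_eq_one_iff _ _).2 ⟨hs1, Or.inl (by simpa using hs)⟩)
  obtain ⟨g, hg⟩ := hex x y hε
  have h1 : D x y ≤ warpedDist S t x y := (warpedDist_isGreatest S t ht).2 hD x y
  exact ⟨g, by linarith⟩

/-- The points moved by at most `R / t` by a nontrivial group element of word length at most
`R`. -/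
def nearFixedPoints (S : Set G) (X : Type*) [MetricSpace X] [MulAction G X] (R t : ℝ) : Set X :=
  {x | ∃ g : G, g ≠ 1 ∧ wordDist S 1 g ≤ R ∧ t * dist x (g • x) ≤ R}

lemma euclidean_norm_le_sum {m : ℕ} (v : EuclideanSpace ℝ (Fin m)) : ‖v‖ ≤ ∑ i, |v i| := by
  rw [EuclideanSpace.norm_eq]
  refine Real.sqrt_le_iff.2 ⟨Finset.sum_nonneg fun i _ => abs_nonneg _, ?_⟩
  exact Finset.sum_sq_le_sq_sum_of_nonneg fun i _ => abs_nonneg _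

lemma sum_abs_le_euclidean_norm {m : ℕ} (v : EuclideanSpace ℝ (Fin m)) :
    ∑ i, |v i| ≤ m * ‖v‖ := by
  refine (Finset.sum_le_sum fun i _ => PiLp.norm_apply_le v i).trans ?_
  simp

/-- The inclusion of `ℤᵐ` into Euclidean space. -/
def intVec {m : ℕ} (v : Fin m → ℤ) : EuclideanSpace ℝ (Fin m) :=
  WithLp.toLp 2 fun i => (v i : ℝ)

/-- Away from the points which are almost fixed, the warped cone over an isometric action on an
`m`-dimensional manifold looks like `G × ℤᵐ`. -/
theorem isLocalModel_warpedDist [IsIsometricSMul G X] (hS : Subgroup.closure S = ⊤) {m : ℕ}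
    {L r : ℝ} (hL : 1 ≤ L) (hch : HasUniformCharts m L r (Set.univ : Set X)) {R : ℝ} (hR : 0 ≤ R)
    (ht : 0 < t) (htr : L * (R + 1) + m < t * r) {x : X}
    (hx : x ∉ nearFixedPoints S X (2 * R + 4 * L * R + 1) t) :
    IsLocalModel (prodIntDist S m) (1, 0) (warpedDist S t) x (L + 1 + m * L) (1 + m * L + m) R := by
  have hd := isGraphMetric_wordDist hS
  have hw : IsMetric (warpedDist S t : X → X → ℝ) := isMetric_warpedDist ht
  obtain ⟨ψ, hψ0, hψ, hsurj⟩ := hch x (Set.mem_univ x)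
  have hm : (0 : ℝ) ≤ m := m.cast_nonneg
  have hmL : 0 ≤ m * L := by positivity
  have hnorm : ∀ v w : Fin m → ℤ, ‖intVec v - intVec w‖ ≤ ∑ i, |(v i : ℝ) - w i| :=
    fun v w => euclidean_norm_le_sum _
  have hnorm' : ∀ v w : Fin m → ℤ, ∑ i, |(v i : ℝ) - w i| ≤ m * ‖intVec v - intVec w‖ :=
    fun v w => sum_abs_le_euclidean_norm (intVec v - intVec w)
  have hscale : ∀ u : EuclideanSpace ℝ (Fin m), t * ‖t⁻¹ • u‖ = ‖u‖ := by
    intro u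
    rw [norm_smul, norm_inv, Real.norm_of_nonneg ht.le, mul_inv_cancel_left₀ ht.ne']
  have hball : ∀ p : G × (Fin m → ℤ), prodIntDist S m (1, 0) p ≤ R →
      wordDist S 1 p.1 ≤ R ∧ ‖intVec p.2‖ ≤ R ∧ ‖t⁻¹ • intVec p.2‖ < r := by
    intro p hp
    have h1 := hd.nonneg 1 p.1
    have h2 : ‖intVec p.2‖ ≤ ∑ i, |((0 : Fin m → ℤ) i : ℝ) - p.2 i| := by
      simpa [intVec] using euclidean_norm_le_sum (intVec p.2)
    have h3 := norm_nonneg (intVec p.2)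
    simp only [prodIntDist] at hp
    have h4 : ‖intVec p.2‖ ≤ R := by linarith
    refine ⟨by linarith, h4, ?_⟩
    refine lt_of_mul_lt_mul_left ?_ ht.le
    rw [hscale]
    nlinarith
  have hr : 0 < r := by
    have : 0 < t * r := lt_of_le_of_lt (by positivity) htr
    exact pos_of_mul_pos_right this ht.le
  have h0r : ‖(0 : EuclideanSpace ℝ (Fin m))‖ < r := by simpa using hr
  have hcentre : ∀ p : G × (Fin m → ℤ), prodIntDist S m (1, 0) p ≤ R →
      t * dist x (ψ (t⁻¹ • intVec p.2)) ≤ L * R := by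
    intro p hp
    obtain ⟨-, h2, h3⟩ := hball p hp
    have h4 := (hψ 0 _ h0r h3).1
    rw [hψ0, zero_sub, norm_neg] at h4
    have h5 := mul_le_mul_of_nonneg_left h4 ht.le
    have h6 := mul_le_mul_of_nonneg_left h2 (zero_le_one.trans hL)
    rw [mul_left_comm, hscale] at h5
    linarith
  -- The inverse makes `q.1⁻¹ * p.1`, whose length is the left-invariant word distance, carry the
  -- sheet of `p` to that of `q`.
  refine ⟨fun p => p.1⁻¹ • ψ (t⁻¹ • intVec p.2), ?_, fun p q hp hq => ?_, fun y hy => ?_⟩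
  · have : intVec (0 : Fin m → ℤ) = 0 := by ext i; simp [intVec]
    simp only [this, smul_zero, hψ0, inv_one, one_smul, hw.self]
    positivity
  · obtain ⟨hp1, hp2, hp3⟩ := hball p hp
    obtain ⟨hq1, hq2, hq3⟩ := hball q hq
    set a := ψ (t⁻¹ • intVec p.2) with ha
    set b := ψ (t⁻¹ • intVec q.2) with hb
    have hab := hψ _ _ hp3 hq3
    rw [← smul_sub] at hab
    have hab1 : t * dist a b ≤ L * ‖intVec p.2 - intVec q.2‖ := by
      have := mul_le_mul_of_nonneg_left hab.1 ht.le
      rwa [mul_left_comm, hscale] at this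
    have hab2 : ‖intVec p.2 - intVec q.2‖ ≤ L * (t * dist a b) := by
      have := mul_le_mul_of_nonneg_left hab.2 ht.le
      rwa [mul_left_comm t L, hscale] at this
    have hpq0 : 0 ≤ ∑ i, |(p.2 i : ℝ) - q.2 i| := Finset.sum_nonneg fun i _ => abs_nonneg _
    have hpq : prodIntDist S m p q = wordDist S p.1 q.1 + ∑ i, |(p.2 i : ℝ) - q.2 i| := rfl
    have hwpq := hd.nonneg p.1 q.1
    have hle : warpedDist S t (p.1⁻¹ • a) (q.1⁻¹ • b) ≤ L * prodIntDist S m p q := by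
      have h1 := warpedDist_le hS ht (q.1⁻¹ * p.1) (p.1⁻¹ • a) (q.1⁻¹ • b)
      rw [wordDist_one_inv_mul hS, smul_smul, mul_assoc, mul_inv_cancel, mul_one, dist_smul,
        hd.symm] at h1
      have h2 := mul_le_mul_of_nonneg_left (hnorm p.2 q.2) (zero_le_one.trans hL)
      have h3 := mul_le_mul_of_nonneg_right hL hwpq
      rw [hpq]
      linarith
    have hd0 : 0 ≤ prodIntDist S m p q := by rw [hpq]; positivity
    refine ⟨?_, ?_⟩
    · have : 0 ≤ (1 + m * L) * prodIntDist S m p q := by positivity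
      linarith
    · have hpqR : prodIntDist S m p q ≤ 2 * R := by
        have hP := isGraphMetric_prodIntDist hS m
        have := hP.triangle p (1, 0) q
        rw [hP.symm p (1, 0)] at this
        linarith
      have hδ := hw.nonneg (p.1⁻¹ • a) (q.1⁻¹ • b)
      obtain ⟨h, hh⟩ := exists_le_warpedDist_add hS ht (p.1⁻¹ • a) (q.1⁻¹ • b) one_pos
      have hLR : warpedDist S t (p.1⁻¹ • a) (q.1⁻¹ • b) ≤ L * (2 * R) :=
        hle.trans (mul_le_mul_of_nonneg_left hpqR (zero_le_one.trans hL))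
      have hh0 := hd.nonneg 1 h
      -- Either the almost optimal translation `h` is the expected one, and the chart gives the
      -- bound, or this element is nontrivial and nearly fixes `x`: its length is at most `2R + 2LR
      -- + 1`, and `t` times its displacement of `x` at most `LR + (2LR + 1) + LR`. Both are within
      -- the radius excluded by `hx`.
      by_cases hg : q.1 * h * p.1⁻¹ = 1
      · have heq : h = q.1⁻¹ * p.1 := by
          rw [mul_inv_eq_one] at hg
          rw [← hg]; simp
        rw [heq, wordDist_one_inv_mul hS, smul_smul, mul_assoc, mul_inv_cancel, mul_one, dist_smul,
          hd.symm] at hh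
        have h1 := hnorm' p.2 q.2
        have h2 := mul_le_mul_of_nonneg_left hab2 hm
        have h3 : t * dist a b ≤ warpedDist S t (p.1⁻¹ • a) (q.1⁻¹ • b) + 1 := by linarith
        have h4 := mul_le_mul_of_nonneg_left h3 hmL
        have h5 := mul_nonneg (zero_le_one.trans hL) hδ
        have h6 : 0 ≤ t * dist a b := mul_nonneg ht.le dist_nonneg
        rw [hpq]
        linarith
      · refine absurd ⟨q.1 * h * p.1⁻¹, hg, ?_, ?_⟩ hx
        · have h1 := wordDist_one_mul_le hS (q.1 * h) p.1⁻¹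
          have h2 := wordDist_one_mul_le hS q.1 h
          rw [wordDist_one_inv hS] at h1
          have h3 : 0 ≤ t * dist (h • p.1⁻¹ • a) (q.1⁻¹ • b) := mul_nonneg ht.le dist_nonneg
          have h4 : 0 ≤ L * R := by positivity
          linarith
        · have h1 := hcentre p hp
          have h2 := hcentre q hq
          have h3 : t * dist b ((q.1 * h * p.1⁻¹) • a) ≤ L * (2 * R) + 1 := by
            have : dist b ((q.1 * h * p.1⁻¹) • a) = dist (h • p.1⁻¹ • a) (q.1⁻¹ • b) := by
              rw [dist_comm, ← dist_smul q.1 (h • _), smul_inv_smul, smul_smul, smul_smul]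
            rw [this]
            linarith
          have h4 := dist_triangle x b ((q.1 * h * p.1⁻¹) • x)
          have h5 := dist_triangle b ((q.1 * h * p.1⁻¹) • a) ((q.1 * h * p.1⁻¹) • x)
          rw [dist_smul, dist_comm a x] at h5
          have h6 := mul_le_mul_of_nonneg_left (h4.trans (add_le_add_right h5 _)) ht.le
          linarith
  · have hδ := hw.nonneg x y
    obtain ⟨h, hh⟩ := exists_le_warpedDist_add hS ht x y one_pos
    have hh0 := hd.nonneg 1 h
    have hd1 : dist (h • x) y = dist x (h⁻¹ • y) := by
      rw [← dist_smul h x, smul_inv_smul]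
    rw [hd1] at hh
    have hd0 : 0 ≤ t * dist x (h⁻¹ • y) := mul_nonneg ht.le dist_nonneg
    have hd2 : t * (L * dist x (h⁻¹ • y)) ≤ L * (warpedDist S t x y + 1) := by
      rw [mul_left_comm]
      exact mul_le_mul_of_nonneg_left (by linarith) (zero_le_one.trans hL)
    have hd3 : L * (warpedDist S t x y + 1) ≤ L * (R + 1) :=
      mul_le_mul_of_nonneg_left (by linarith) (zero_le_one.trans hL)
    obtain ⟨u, hu, hψu⟩ := hsurj (h⁻¹ • y) (lt_of_mul_lt_mul_left (by linarith) ht.le)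
    have hut : t * ‖u‖ ≤ L * (warpedDist S t x y + 1) := by
      have h1 := (hψ u 0 hu h0r).2
      rw [hψ0, hψu, sub_zero, dist_comm] at h1
      exact (mul_le_mul_of_nonneg_left h1 ht.le).trans hd2
    -- Rounding costs at most `1` per coordinate, hence at most `m` in norm; the summand `m` in
    -- `htr` keeps the rounded point inside the chart.
    let v : Fin m → ℤ := fun i => ⌊t * u i⌋
    have hv : ∀ i, |(v i : ℝ) - t * u i| ≤ 1 := by
      intro i
      have h1 := Int.floor_le (t * u i)
      have h2 := Int.lt_floor_add_one (t * u i)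
      rw [abs_le]
      constructor <;> linarith
    have hvu : ‖intVec v - t • u‖ ≤ m := by
      refine (euclidean_norm_le_sum _).trans ?_
      calc ∑ i, |(intVec v - t • u) i| ≤ ∑ _i : Fin m, (1 : ℝ) :=
            Finset.sum_le_sum fun i _ => hv i
        _ = m := by simp
    have hvu' : t * ‖t⁻¹ • intVec v - u‖ ≤ m := by
      have : t⁻¹ • intVec v - u = t⁻¹ • (intVec v - t • u) := by
        rw [smul_sub, inv_smul_smul₀ ht.ne']
      rwa [this, hscale]
    have hvr : ‖t⁻¹ • intVec v‖ < r := by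
      have h1 : ‖t⁻¹ • intVec v‖ ≤ ‖t⁻¹ • intVec v - u‖ + ‖u‖ := by
        simpa using norm_add_le (t⁻¹ • intVec v - u) u
      have h2 := mul_le_mul_of_nonneg_left h1 ht.le
      exact lt_of_mul_lt_mul_left (by linarith) ht.le
    refine ⟨(h⁻¹, v), ?_, ?_⟩
    · have h1 : ∑ i, |((0 : Fin m → ℤ) i : ℝ) - v i| ≤ m * (t * ‖u‖) + m := by
        have : ∀ i ∈ Finset.univ, |((0 : Fin m → ℤ) i : ℝ) - v i| ≤ t * ‖u‖ + 1 := by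
          intro i _
          have h2 : |u i| ≤ ‖u‖ := PiLp.norm_apply_le u i
          have h3 := mul_le_mul_of_nonneg_left h2 ht.le
          have h4 : |(v i : ℝ)| ≤ |(v i : ℝ) - t * u i| + |t * u i| := by
            simpa using abs_add_le ((v i : ℝ) - t * u i) (t * u i)
          rw [abs_mul, abs_of_pos ht] at h4
          simp only [Pi.zero_apply, Int.cast_zero, zero_sub, abs_neg]
          linarith [hv i]
        refine (Finset.sum_le_sum this).trans (le_of_eq ?_)
        simp only [Finset.sum_const, Finset.card_univ, Fintype.card_fin, nsmul_eq_mul]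
        ring
      have h2 := mul_le_mul_of_nonneg_left hut hm
      have h3 := mul_nonneg (zero_le_one.trans hL) hδ
      simp only [prodIntDist, wordDist_one_inv hS]
      linarith
    · have h1 := (warpedDist_isGreatest (X := X) S t ht).1.2.1 y (h • ψ (t⁻¹ • intVec v))
      have h2 : dist y (h • ψ (t⁻¹ • intVec v)) = dist (ψ (t⁻¹ • intVec v)) (ψ u) := by
        rw [hψu, ← dist_smul h _ (h⁻¹ • y), smul_inv_smul, dist_comm]
      have h3 := mul_le_mul_of_nonneg_left (hψ _ _ hvr hu).1 ht.le
      have h4 := mul_le_mul_of_nonneg_left hvu' (zero_le_one.trans hL)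
      rw [h2] at h1
      simp only [inv_inv]
      linarith

end Warped

/-! ### Volume of balls and coverings -/

section BallMeasure
open Metric Set
open scoped NNReal ENNReal Topology

/-- The measure of balls of radius `ρ` is comparable to `ρᵐ`. -/
structure IsAhlforsRegular {X : Type*} [MetricSpace X] [MeasurableSpace X] (μ : Measure X)
    (m : ℕ) (c C ρ₀ : ℝ) : Prop where
  c_pos : 0 < c
  C_pos : 0 < C
  radius_pos : 0 < ρ₀
  le_ball : ∀ x ρ, 0 < ρ → ρ ≤ ρ₀ → c * ρ ^ m ≤ μ.real (closedBall x ρ)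
  ball_le : ∀ x ρ, 0 < ρ → μ.real (closedBall x ρ) ≤ C * ρ ^ m

lemma isAddHaarMeasure_hausdorffMeasure_euclidean (m : ℕ) :
    (Measure.hausdorffMeasure (m : ℝ) : Measure (EuclideanSpace ℝ (Fin m))).IsAddHaarMeasure := by
  simpa using MeasureTheory.isAddHaarMeasure_hausdorffMeasure (E := EuclideanSpace ℝ (Fin m))

variable {X : Type*} [MetricSpace X] [MeasurableSpace X] [BorelSpace X] {m : ℕ} {L r : ℝ}

lemma hausdorffMeasure_closedBall_le (hL : 1 ≤ L) (h : HasUniformCharts m L r (univ : Set X))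
    (x : X) {ρ : ℝ} (hρ : 0 < ρ) (hρr : L * ρ < r) :
    Measure.hausdorffMeasure (m : ℝ) (closedBall x ρ) ≤
      ENNReal.ofReal (L ^ m * (L * ρ) ^ m) *
        Measure.hausdorffMeasure (m : ℝ) (ball (0 : EuclideanSpace ℝ (Fin m)) 1) := by
  have := isAddHaarMeasure_hausdorffMeasure_euclidean m
  have hL0 : 0 < L := by linarith
  obtain ⟨ψ, hψ0, hψ, hsurj⟩ := h x (mem_univ x)
  have hsub : closedBall x ρ ⊆ ψ '' closedBall 0 (L * ρ) := by
    intro y hy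
    have hy' : dist x y ≤ ρ := by rw [dist_comm]; exact hy
    have hle : L * dist x y ≤ L * ρ := mul_le_mul_of_nonneg_left hy' hL0.le
    obtain ⟨u, hu, rfl⟩ := hsurj y (by linarith)
    refine ⟨u, ?_, rfl⟩
    have := (hψ u 0 hu (by simpa using (norm_nonneg u).trans_lt hu)).2
    rw [hψ0, sub_zero, dist_comm] at this
    rw [mem_closedBall_zero_iff]
    linarith
  have hlip : LipschitzOnWith L.toNNReal ψ (closedBall 0 (L * ρ)) := by
    refine LipschitzOnWith.of_dist_le_mul fun u hu v hv => ?_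
    rw [mem_closedBall_zero_iff] at hu hv
    rw [Real.coe_toNNReal _ hL0.le, dist_eq_norm]
    exact (hψ u v (by linarith) (by linarith)).1
  refine (measure_mono hsub).trans ((hlip.hausdorffMeasure_image_le m.cast_nonneg).trans ?_)
  rw [Measure.addHaar_closedBall _ _ (by positivity), finrank_euclideanSpace_fin,
    ENNReal.ofReal_mul (by positivity), mul_assoc, ENNReal.rpow_natCast,
    ENNReal.ofReal_pow hL0.le]
  rfl

/-- The inverse parametrization is `L`-Lipschitz on the image of the `ρ / L`-ball, which lies in the
ball around `x`. -/
lemma le_hausdorffMeasure_closedBall (hL : 1 ≤ L) (h : HasUniformCharts m L r (univ : Set X))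
    (x : X) {ρ : ℝ} (hρ : 0 < ρ) (hρr : ρ < r) :
    ENNReal.ofReal ((ρ / L) ^ m) *
        Measure.hausdorffMeasure (m : ℝ) (ball (0 : EuclideanSpace ℝ (Fin m)) 1) ≤
      ENNReal.ofReal (L ^ m) * Measure.hausdorffMeasure (m : ℝ) (closedBall x ρ) := by
  have := isAddHaarMeasure_hausdorffMeasure_euclidean m
  have hL0 : 0 < L := by linarith
  obtain ⟨ψ, hψ0, hψ, -⟩ := h x (mem_univ x)
  have hρL : ρ / L < r := (div_le_self hρ.le hL).trans_lt hρr
  have hinj : InjOn ψ (ball 0 (ρ / L)) := by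
    intro u hu v hv huv
    rw [mem_ball_zero_iff] at hu hv
    have := (hψ u v (by linarith) (by linarith)).2
    rw [huv, dist_self, mul_zero] at this
    exact sub_eq_zero.1 (norm_le_zero_iff.1 this)
  have hsub : ψ '' ball 0 (ρ / L) ⊆ closedBall x ρ := by
    rintro _ ⟨u, hu, rfl⟩
    rw [mem_ball_zero_iff] at hu
    have h1 := (hψ u 0 (by linarith) (by simpa using hρ.trans hρr)).1
    rw [hψ0, sub_zero] at h1
    rw [mem_closedBall]
    have h2 : L * ‖u‖ ≤ L * (ρ / L) := mul_le_mul_of_nonneg_left hu.le hL0.le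
    rw [mul_div_cancel₀ _ hL0.ne'] at h2
    linarith
  have hlip : LipschitzOnWith L.toNNReal (Function.invFunOn ψ (ball 0 (ρ / L)))
      (ψ '' ball 0 (ρ / L)) := by
    refine LipschitzOnWith.of_dist_le_mul ?_
    rintro _ ⟨u, hu, rfl⟩ _ ⟨v, hv, rfl⟩
    rw [hinj.leftInvOn_invFunOn hu, hinj.leftInvOn_invFunOn hv, Real.coe_toNNReal _ hL0.le,
      dist_eq_norm]
    rw [mem_ball_zero_iff] at hu hv
    exact (hψ u v (by linarith) (by linarith)).2
  have himg := hlip.hausdorffMeasure_image_le (d := (m : ℝ)) m.cast_nonneg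
  rw [hinj.leftInvOn_invFunOn.image_image, Measure.addHaar_ball_of_pos _ _ (div_pos hρ hL0),
    finrank_euclideanSpace_fin, ENNReal.rpow_natCast] at himg
  refine himg.trans ?_
  rw [ENNReal.ofReal_pow hL0.le]
  exact mul_le_mul_right (measure_mono hsub) _

lemma isFiniteMeasure_hausdorffMeasure [CompactSpace X] (hL : 1 ≤ L) (hr : 0 < r)
    (h : HasUniformCharts m L r (univ : Set X)) :
    IsFiniteMeasure (Measure.hausdorffMeasure (m : ℝ) : Measure X) := by
  have := isAddHaarMeasure_hausdorffMeasure_euclidean m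
  have hL0 : 0 < L := by linarith
  refine ⟨isCompact_univ.measure_lt_top_of_nhdsWithin fun x _ => ?_⟩
  have hρ : 0 < r / (2 * L) := by positivity
  have hρr : L * (r / (2 * L)) < r := by
    have : L * (r / (2 * L)) = r / 2 := by field_simp
    linarith
  refine ⟨closedBall x (r / (2 * L)), mem_nhdsWithin_of_mem_nhds (closedBall_mem_nhds x hρ), ?_⟩
  refine (hausdorffMeasure_closedBall_le hL h x hρ hρr).trans_lt ?_
  exact ENNReal.mul_lt_top ENNReal.ofReal_lt_top measure_ball_lt_top

theorem exists_isAhlforsRegular [CompactSpace X] (hL : 1 ≤ L) (hr : 0 < r)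
    (h : HasUniformCharts m L r (univ : Set X)) :
    ∃ c C ρ₀, IsAhlforsRegular (Measure.hausdorffMeasure (m : ℝ) : Measure X) m c C ρ₀ := by
  have := isAddHaarMeasure_hausdorffMeasure_euclidean m
  have := isFiniteMeasure_hausdorffMeasure hL hr h
  have hL0 : 0 < L := by linarith
  set V : ℝ := (Measure.hausdorffMeasure (m : ℝ)).real (ball (0 : EuclideanSpace ℝ (Fin m)) 1)
    with hV
  have hVpos : 0 < V :=
    ENNReal.toReal_pos (measure_ball_pos _ _ one_pos).ne' measure_ball_lt_top.ne
  set W : ℝ := (Measure.hausdorffMeasure (m : ℝ)).real (univ : Set X) with hW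
  have hρ : 0 < r / (2 * L) := by positivity
  -- Charts only control small radii; for radii at least `r / (2 * L)` the second summand of the
  -- upper constant already accounts for the total mass `W`.
  refine ⟨V / (L ^ m * L ^ m), L ^ m * L ^ m * V + W / (r / (2 * L)) ^ m, r / 2, by positivity,
    by positivity, by positivity, fun x ρ hρ0 hρr => ?_, fun x ρ hρ0 => ?_⟩
  · have h1 := le_hausdorffMeasure_closedBall hL h x hρ0 (by linarith)
    have h2 := ENNReal.toReal_mono (ENNReal.mul_ne_top ENNReal.ofReal_ne_top
      (measure_ne_top _ _)) h1
    rw [ENNReal.toReal_mul, ENNReal.toReal_mul, ENNReal.toReal_ofReal (by positivity),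
      ENNReal.toReal_ofReal (by positivity), div_pow, ← measureReal_def, ← measureReal_def,
      ← hV] at h2
    rw [div_mul_eq_mul_div, div_le_iff₀ (by positivity)]
    rw [div_mul_eq_mul_div, div_le_iff₀ (by positivity)] at h2
    linarith
  · rcases lt_or_ge ρ (r / (2 * L)) with hlt | hge
    · have hρr : L * ρ < r := by
        have h1 := mul_lt_mul_of_pos_left hlt hL0
        have : L * (r / (2 * L)) = r / 2 := by field_simp
        linarith
      have h1 := hausdorffMeasure_closedBall_le hL h x hρ0 hρr
      have h2 := ENNReal.toReal_mono (ENNReal.mul_ne_top ENNReal.ofReal_ne_top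
        measure_ball_lt_top.ne) h1
      rw [ENNReal.toReal_mul, ENNReal.toReal_ofReal (by positivity), ← measureReal_def,
        ← measureReal_def, ← hV, mul_pow] at h2
      have h3 : 0 ≤ W / (r / (2 * L)) ^ m * ρ ^ m := by positivity
      linarith
    · have h1 : (Measure.hausdorffMeasure (m : ℝ)).real (closedBall x ρ) ≤ W :=
        measureReal_mono (subset_univ _)
      have h2 : (r / (2 * L)) ^ m ≤ ρ ^ m := pow_le_pow_left₀ hρ.le hge m
      have h3 : W ≤ W / (r / (2 * L)) ^ m * ρ ^ m := by
        rw [div_mul_eq_mul_div, le_div_iff₀ (by positivity)]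
        exact mul_le_mul_of_nonneg_left h2 measureReal_nonneg
      have h4 : 0 ≤ L ^ m * L ^ m * V * ρ ^ m := by positivity
      linarith

/-- A set is covered by balls of radius `2 * ρ` whose number is controlled by the measure of a
neighbourhood. -/
lemma IsAhlforsRegular.exists_cover {μ : Measure X} [IsFiniteMeasure μ] {c C ρ₀ : ℝ}
    (h : IsAhlforsRegular μ m c C ρ₀) {A B : Set X} {ρ : ℝ} (hρ : 0 < ρ) (hρ₀ : ρ ≤ ρ₀)
    (hAB : ∀ a ∈ A, closedBall a ρ ⊆ B) :
    ∃ F : Finset X, (∀ a ∈ A, ∃ p ∈ F, dist a p ≤ 2 * ρ) ∧ F.card * (c * ρ ^ m) ≤ μ.real B := by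
  -- A `2 * ρ`-separated subset of maximal cardinality: its `ρ`-balls are disjoint, which bounds the
  -- cardinality, and maximality makes it a `2 * ρ`-net.
  let P : Set ℕ := {n | ∃ F : Finset X, ↑F ⊆ A ∧
    (F : Set X).Pairwise (fun x y => 2 * ρ < dist x y) ∧ F.card = n}
  have hcard : ∀ F : Finset X, ↑F ⊆ A → (F : Set X).Pairwise (fun x y => 2 * ρ < dist x y) →
      F.card * (c * ρ ^ m) ≤ μ.real B := by
    intro F hF hsep
    have hdisj : (F : Set X).PairwiseDisjoint (fun p => closedBall p ρ) := by
      intro x hx y hy hxy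
      exact closedBall_disjoint_closedBall (by linarith [hsep hx hy hxy])
    calc F.card * (c * ρ ^ m) = ∑ _p ∈ F, c * ρ ^ m := by simp
      _ ≤ ∑ p ∈ F, μ.real (closedBall p ρ) := Finset.sum_le_sum fun p _ => h.le_ball p ρ hρ hρ₀
      _ = μ.real (⋃ p ∈ F, closedBall p ρ) :=
        (measureReal_biUnion_finset hdisj fun p _ => measurableSet_closedBall).symm
      _ ≤ μ.real B := measureReal_mono (iUnion₂_subset fun p hp => hAB p (hF hp))
  have hpos : 0 < c * ρ ^ m := mul_pos h.c_pos (pow_pos hρ m)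
  have hbdd : BddAbove P := by
    refine ⟨⌊μ.real B / (c * ρ ^ m)⌋₊, ?_⟩
    rintro n ⟨F, hF, hsep, rfl⟩
    exact Nat.le_floor ((le_div_iff₀ hpos).2 (hcard F hF hsep))
  obtain ⟨F, hF, hsep, hmax⟩ := Nat.sSup_mem (s := P) ⟨0, ∅, by simp, by simp, rfl⟩ hbdd
  refine ⟨F, fun a ha => ?_, hcard F hF hsep⟩
  by_contra! hfar
  have haF : a ∉ F := fun haF => by
    have := hfar a haF
    rw [dist_self] at this
    linarith
  classical
  have hmem : F.card + 1 ∈ P := by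
    refine ⟨insert a F, ?_, ?_, Finset.card_insert_of_notMem haF⟩
    · rw [Finset.coe_insert]
      exact insert_subset ha hF
    · rw [Finset.coe_insert]
      refine hsep.insert fun y hy _ => ⟨hfar y hy, ?_⟩
      rw [dist_comm]
      exact hfar y hy
  have := le_csSup hbdd hmem
  omega

end BallMeasure

/-! ### Volume of warped balls and of nearly fixed points -/

section WarpedMeasure
open Metric Set
open scoped NNReal ENNReal Topology

variable {G : Type*} [Group G] {S : Set G} {X : Type*} [MetricSpace X] [MulAction G X]

lemma nearFixedPoints_anti {R t t' : ℝ} (h : t ≤ t') :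
    nearFixedPoints S X R t' ⊆ nearFixedPoints S X R t := by
  rintro x ⟨g, hg, hgR, hx⟩
  exact ⟨g, hg, hgR, (mul_le_mul_of_nonneg_right h dist_nonneg).trans hx⟩

/-- At a free point the finitely many nontrivial elements of length at most `R` all have positive
displacement, which exceeds `R / n` for large `n`. -/
lemma iInter_nearFixedPoints_subset (hS : Subgroup.closure S = ⊤) (hfin : S.Finite) (R : ℝ) :
    ⋂ n : ℕ, nearFixedPoints S X R n ⊆ {x : X | MulAction.stabilizer G x ≠ ⊥} := by
  intro x hx hbot
  have key : ∀ g ∈ {g : G | wordDist S 1 g ≤ R}, ∀ᶠ n : ℕ in atTop,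
      g ≠ 1 → R < n * dist x (g • x) := by
    intro g _
    by_cases hg : g = 1
    · exact Eventually.of_forall fun n h => absurd hg h
    · have hne : g • x ≠ x := fun h => by
        have : g ∈ MulAction.stabilizer G x := h
        rw [hbot] at this
        exact hg (by simpa using this)
      have hpos : 0 < dist x (g • x) := dist_pos.2 hne.symm
      have := tendsto_natCast_atTop_atTop.atTop_mul_const hpos
      filter_upwards [this.eventually_gt_atTop R] with n hn _
      exact hn
  obtain ⟨n, hn⟩ := ((eventually_all_finite (finite_wordDist_ball hS hfin R)).2 key).exists
  obtain ⟨g, hg, hgR, hle⟩ := mem_iInter.1 hx n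
  exact (hn g hgR hg).not_ge hle

variable [IsIsometricSMul G X]

lemma isClosed_nearFixedPoints (hS : Subgroup.closure S = ⊤) (hfin : S.Finite) (R t : ℝ) :
    IsClosed (nearFixedPoints S X R t) := by
  have : nearFixedPoints S X R t =
      ⋃ g ∈ {g : G | wordDist S 1 g ≤ R} \ {1}, {x : X | t * dist x (g • x) ≤ R} := by
    ext x
    simp only [nearFixedPoints, mem_ofPred_eq, mem_iUnion, Set.mem_sdiff, mem_singleton_iff, exists_prop]
    exact exists_congr fun g => by tauto
  rw [this]
  refine ((finite_wordDist_ball hS hfin R).sdiff).isClosed_biUnion fun g _ => ?_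
  exact isClosed_le (continuous_const.mul (continuous_id.dist (isometry_smul X g).continuous))
    continuous_const

variable [MeasurableSpace X] {m : ℕ}

/-- A warped ball of nonnegative radius `D` lies in the union of the balls of radius `(D + 1) / t`
around `g • x` with `|g| ≤ D + 1`, whose number does not depend on `t` or `x`. -/
lemma exists_measure_warpedDist_ball_le {μ : Measure X} [IsFiniteMeasure μ] {c C ρ₀ : ℝ}
    (h : IsAhlforsRegular μ m c C ρ₀) (hS : Subgroup.closure S = ⊤) (hfin : S.Finite) (D : ℝ) :
    ∃ B, 0 ≤ B ∧ ∀ t, 0 < t → ∀ x : X, μ.real {y | warpedDist S t x y ≤ D} ≤ B / t ^ m := by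
  have hd := isGraphMetric_wordDist hS
  set E := max D 0 + 1 with hE
  have hE0 : 0 < E := by positivity
  set F := (finite_wordDist_ball hS hfin E).toFinset with hF
  have hC := h.C_pos
  refine ⟨F.card * (C * E ^ m), by positivity, fun t ht x => ?_⟩
  have hsub : {y | warpedDist S t x y ≤ D} ⊆ ⋃ g ∈ F, closedBall (g • x) (E / t) := by
    intro y hy
    obtain ⟨g, hg⟩ := exists_le_warpedDist_add hS ht x y one_pos
    have h1 := hd.nonneg 1 g
    have h2 : 0 ≤ t * dist (g • x) y := mul_nonneg ht.le dist_nonneg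
    have h3 : warpedDist S t x y ≤ max D 0 := le_max_of_le_left hy
    simp only [mem_iUnion]
    refine ⟨g, ?_, ?_⟩
    · rw [hF, Set.Finite.mem_toFinset]
      show wordDist S 1 g ≤ E
      linarith
    · rw [mem_closedBall, dist_comm, le_div_iff₀ ht]
      linarith
  calc μ.real {y | warpedDist S t x y ≤ D}
      ≤ μ.real (⋃ g ∈ F, closedBall (g • x) (E / t)) := measureReal_mono hsub (measure_ne_top _ _)
    _ ≤ ∑ g ∈ F, μ.real (closedBall (g • x) (E / t)) := measureReal_biUnion_finset_le _ _
    _ ≤ ∑ _g ∈ F, C * (E / t) ^ m :=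
      Finset.sum_le_sum fun g _ => h.ball_le _ _ (div_pos hE0 ht)
    _ = F.card * (C * E ^ m) / t ^ m := by
      rw [Finset.sum_const, nsmul_eq_mul, div_pow]
      ring

variable [BorelSpace X]

/-- Continuity from above along integer levels, extended to real levels by monotonicity and rounding
down. -/
lemma tendsto_measure_nearFixedPoints {μ : Measure X} [IsFiniteMeasure μ]
    (hS : Subgroup.closure S = ⊤) (hfin : S.Finite)
    (hfree : μ {x : X | MulAction.stabilizer G x ≠ ⊥} = 0) (R : ℝ) {t : ℕ → ℝ}
    (ht : Tendsto t atTop atTop) :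
    Tendsto (fun k => μ.real (nearFixedPoints S X R (t k))) atTop (𝓝 0) := by
  have hanti : Antitone fun n : ℕ => nearFixedPoints S X R (n : ℝ) :=
    fun n n' h => nearFixedPoints_anti (Nat.cast_le.2 h)
  have h1 := tendsto_measure_iInter_atTop (μ := μ)
    (fun n : ℕ => (isClosed_nearFixedPoints (X := X) hS hfin R n).measurableSet.nullMeasurableSet)
    hanti ⟨0, measure_ne_top _ _⟩
  rw [measure_mono_null (iInter_nearFixedPoints_subset hS hfin R) hfree] at h1
  have h2 : Tendsto (fun n : ℕ => μ.real (nearFixedPoints S X R (n : ℝ))) atTop (𝓝 0) :=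
    (ENNReal.tendsto_toReal ENNReal.zero_ne_top).comp h1
  have h3 := h2.comp (tendsto_nat_floor_atTop.comp ht)
  refine squeeze_zero' (Eventually.of_forall fun _ => measureReal_nonneg) ?_ h3
  filter_upwards [ht.eventually_ge_atTop 0] with k hk
  exact measureReal_mono (nearFixedPoints_anti (Nat.floor_le hk))

end WarpedMeasure

/-! ### Base points that are good on both sides -/

section GoodPoints
open Metric Set
open scoped NNReal ENNReal Topology

variable {G : Type*} [Group G] {S : Set G} {X : Type*} [MetricSpace X] [MulAction G X]
  [MeasurableSpace X] {m : ℕ} {μ : Measure X}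
  [IsFiniteMeasure μ] {c C ρ₀ : ℝ}
  {H : Type*} [Group H] {T : Set H} {Y : Type*} [MetricSpace Y] [MulAction H Y]
  [IsIsometricSMul H Y] [MeasurableSpace Y] {n : ℕ} {ν : Measure Y}
  [IsFiniteMeasure ν] {c' C' ρ₀' : ℝ}

/-- A map between levels of warped cones with coarsely dense image cannot increase the growth
of the volume. -/
lemma exists_volume_comparison [BorelSpace X] (hμ : IsAhlforsRegular μ m c C ρ₀)
    (hν : IsAhlforsRegular ν n c' C' ρ₀') (hν0 : 0 < ν.real univ)
    (hT : Subgroup.closure T = ⊤) (hTfin : T.Finite) (a D : ℝ) :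
    ∃ K, 0 ≤ K ∧ ∀ t s : ℝ, 1 / (2 * ρ₀) ≤ t → 0 < s → ∀ f : X → Y,
      (∀ x x', warpedDist S t x x' ≤ 1 → warpedDist T s (f x) (f x') ≤ a) →
      (∀ y, ∃ x, warpedDist T s y (f x) ≤ D) → s ^ n ≤ K * t ^ m := by
  obtain ⟨B, hB, hball⟩ := exists_measure_warpedDist_ball_le hν hT hTfin (a + D)
  have hc := hμ.c_pos
  refine ⟨B * (μ.real univ * 2 ^ m / c) / ν.real univ, by positivity,
    fun t s ht hs f hf hD => ?_⟩
  have hρ₀ := hμ.radius_pos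
  have ht0 : 0 < t := lt_of_lt_of_le (by positivity) ht
  have hw : IsMetric (warpedDist T s : Y → Y → ℝ) := isMetric_warpedDist hs
  have hρle : 1 / (2 * t) ≤ ρ₀ := by
    rw [div_le_iff₀ (by positivity)] at ht ⊢
    linarith
  -- Points of each covering ball are within warped distance `1` of its centre. So the `O(t^m)`
  -- images of centres are `(a + D)`-dense in `Y`, and each accounts for volume `O(s^(-n))` only.
  obtain ⟨F, hF, hcard⟩ := hμ.exists_cover (A := univ) (B := univ) (ρ := 1 / (2 * t))
    (by positivity) hρle fun _ _ => subset_univ _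
  have hsub : (univ : Set Y) ⊆ ⋃ p ∈ F, {y | warpedDist T s (f p) y ≤ a + D} := by
    intro y _
    obtain ⟨x, hx⟩ := hD y
    obtain ⟨p, hp, hxp⟩ := hF x (mem_univ x)
    have h1 : warpedDist S t p x ≤ 1 := by
      refine ((warpedDist_isGreatest (X := X) S t ht0).1.2.1 p x).trans ?_
      rw [dist_comm]
      have := mul_le_mul_of_nonneg_left hxp ht0.le
      have h2 : t * (2 * (1 / (2 * t))) = 1 := by field_simp
      linarith
    have h2 := hf p x h1
    have h3 := hw.triangle (f p) (f x) y
    rw [hw.symm (f x) y] at h3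
    simp only [mem_iUnion]
    exact ⟨p, hp, show warpedDist T s (f p) y ≤ a + D by linarith⟩
  have h1 : ν.real univ ≤ F.card * (B / s ^ n) :=
    calc ν.real univ ≤ ν.real (⋃ p ∈ F, {y | warpedDist T s (f p) y ≤ a + D}) :=
          measureReal_mono hsub (measure_ne_top _ _)
      _ ≤ ∑ p ∈ F, ν.real {y | warpedDist T s (f p) y ≤ a + D} :=
          measureReal_biUnion_finset_le _ _
      _ ≤ ∑ _p ∈ F, B / s ^ n := Finset.sum_le_sum fun p _ => hball s hs (f p)
      _ = _ := by simp
  have h2 : (F.card : ℝ) ≤ μ.real univ * 2 ^ m / c * t ^ m := by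
    rw [div_pow, one_pow, mul_pow, mul_one_div, mul_div_assoc', div_le_iff₀ (by positivity)]
      at hcard
    rw [div_mul_eq_mul_div, le_div_iff₀ hc]
    linarith
  have hsn : 0 < s ^ n := pow_pos hs n
  rw [mul_div_assoc', le_div_iff₀ hsn] at h1
  rw [div_mul_eq_mul_div, le_div_iff₀ hν0]
  have h3 := mul_le_mul_of_nonneg_left h2 hB
  linarith

variable [IsIsometricSMul G X] [BorelSpace Y]

/-- Coarse embeddings between levels of warped cones of comparable volume growth have preimages
whose volume is controlled. -/
lemma exists_measure_preimage_nearFixedPoints_le (hμ : IsAhlforsRegular μ m c C ρ₀)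
    (hν : IsAhlforsRegular ν n c' C' ρ₀')
    (hS : Subgroup.closure S = ⊤) (hSfin : S.Finite) (b R : ℝ) :
    ∃ K, 0 ≤ K ∧ ∀ t s : ℝ, 0 < t → 1 / (2 * ρ₀') ≤ s → ∀ f : X → Y,
      (∀ x x', warpedDist T s (f x) (f x') ≤ 2 → warpedDist S t x x' ≤ b) →
      μ.real (f ⁻¹' nearFixedPoints T Y R s) * t ^ m ≤
        K * s ^ n * ν.real (nearFixedPoints T Y (R + 1) s) := by
  obtain ⟨B, hB, hball⟩ := exists_measure_warpedDist_ball_le hμ hS hSfin b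
  have hc := hν.c_pos
  refine ⟨B * (2 ^ n / c'), by positivity, fun t s ht hs f hf => ?_⟩
  have hρ₀ := hν.radius_pos
  have hs0 : 0 < s := lt_of_lt_of_le (by positivity) hs
  have hρle : 1 / (2 * s) ≤ ρ₀' := by
    rw [div_le_iff₀ (by positivity)] at hs ⊢
    linarith
  -- Moving a point by `1 / (2 * s)` changes its displacement by at most `1 / s`, whence `R + 1`.
  have hnbhd : ∀ a ∈ nearFixedPoints T Y R s,
      closedBall a (1 / (2 * s)) ⊆ nearFixedPoints T Y (R + 1) s := by
    rintro a ⟨g, hg, hgR, ha⟩ y hy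
    refine ⟨g, hg, by linarith, ?_⟩
    rw [mem_closedBall] at hy
    have h1 := dist_triangle y a (g • y)
    have h2 := dist_triangle a (g • a) (g • y)
    rw [dist_smul, dist_comm a y] at h2
    have h3 : dist y (g • y) ≤ dist a (g • a) + 2 * (1 / (2 * s)) := by linarith
    have h4 := mul_le_mul_of_nonneg_left h3 hs0.le
    have h5 : s * (2 * (1 / (2 * s))) = 1 := by field_simp
    linarith
  obtain ⟨F, hF, hcard⟩ := hν.exists_cover (ρ := 1 / (2 * s)) (by positivity) hρle hnbhd
  -- Two points of such a preimage have images at warped distance at most `2`, so the preimage lies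
  -- in a warped `b`-ball. Only monotonicity and subadditivity of `μ` enter, so `f` may be
  -- non-measurable.
  have hpre : ∀ p : Y, μ.real (f ⁻¹' closedBall p (2 * (1 / (2 * s)))) ≤ B / t ^ m := by
    intro p
    rcases (f ⁻¹' closedBall p (2 * (1 / (2 * s)))).eq_empty_or_nonempty with h | ⟨x₀, hx₀⟩
    · rw [h, measureReal_empty]
      positivity
    · refine (measureReal_mono (fun x hx => ?_) (measure_ne_top _ _)).trans (hball t ht x₀)
      refine hf x₀ x (((warpedDist_isGreatest (X := Y) T s hs0).1.2.1 _ _).trans ?_)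
      rw [mem_preimage, mem_closedBall] at hx₀ hx
      have h1 := dist_triangle_right (f x₀) (f x) p
      have h2 : dist (f x₀) (f x) ≤ 2 * (2 * (1 / (2 * s))) := by linarith
      have h3 := mul_le_mul_of_nonneg_left h2 hs0.le
      have h4 : s * (2 * (2 * (1 / (2 * s)))) = 2 := by field_simp
      linarith
  have hsub : f ⁻¹' nearFixedPoints T Y R s ⊆
      ⋃ p ∈ F, f ⁻¹' closedBall p (2 * (1 / (2 * s))) := by
    intro x hx
    obtain ⟨p, hp, hxp⟩ := hF _ hx
    simp only [mem_iUnion]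
    exact ⟨p, hp, hxp⟩
  have h1 : μ.real (f ⁻¹' nearFixedPoints T Y R s) ≤ F.card * (B / t ^ m) :=
    calc μ.real (f ⁻¹' nearFixedPoints T Y R s)
        ≤ μ.real (⋃ p ∈ F, f ⁻¹' closedBall p (2 * (1 / (2 * s)))) :=
          measureReal_mono hsub (measure_ne_top _ _)
      _ ≤ ∑ p ∈ F, μ.real (f ⁻¹' closedBall p (2 * (1 / (2 * s)))) :=
          measureReal_biUnion_finset_le _ _
      _ ≤ ∑ _p ∈ F, B / t ^ m := Finset.sum_le_sum fun p _ => hpre p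
      _ = _ := by simp
  have h2 : (F.card : ℝ) ≤ 2 ^ n / c' * s ^ n * ν.real (nearFixedPoints T Y (R + 1) s) := by
    rw [div_pow, one_pow, mul_pow, mul_one_div, mul_div_assoc', div_le_iff₀ (by positivity)]
      at hcard
    rw [div_mul_eq_mul_div, div_mul_eq_mul_div, le_div_iff₀ hc]
    linarith
  have htm : 0 < t ^ m := pow_pos ht m
  rw [mul_div_assoc', le_div_iff₀ htm] at h1
  have h3 := mul_le_mul_of_nonneg_left h2 hB
  linarith

/-- For uniformly coarsely dense coarse embeddings between levels of warped cones, there are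
points which, as well as their images, are far from being fixed by short group elements. -/
theorem eventually_exists_notMem_nearFixedPoints [BorelSpace X]
    (hμ : IsAhlforsRegular μ m c C ρ₀) (hν : IsAhlforsRegular ν n c' C' ρ₀')
    (hμ0 : 0 < μ.real univ) (hν0 : 0 < ν.real univ)
    (hS : Subgroup.closure S = ⊤) (hSfin : S.Finite)
    (hT : Subgroup.closure T = ⊤) (hTfin : T.Finite)
    (hSfree : μ {x : X | MulAction.stabilizer G x ≠ ⊥} = 0)
    (hTfree : ν {y : Y | MulAction.stabilizer H y ≠ ⊥} = 0)
    {t s : ℕ → ℝ} (ht : Tendsto t atTop atTop) (hs : Tendsto s atTop atTop) {f : ℕ → X → Y}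
    (hup : ∀ r, ∃ r', ∀ k a b, warpedDist S (t k) a b ≤ r →
      warpedDist T (s k) (f k a) (f k b) ≤ r')
    (hlow : ∀ r, ∃ r', ∀ k a b, warpedDist T (s k) (f k a) (f k b) ≤ r →
      warpedDist S (t k) a b ≤ r')
    {D : ℝ} (hD : ∀ k b, ∃ a, warpedDist T (s k) b (f k a) ≤ D) (R : ℝ) :
    ∀ᶠ k in atTop, ∃ x, x ∉ nearFixedPoints S X R (t k) ∧
      f k x ∉ nearFixedPoints T Y R (s k) := by
  obtain ⟨a, ha⟩ := hup 1
  obtain ⟨b, hb⟩ := hlow 2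
  obtain ⟨K, hK, hvol⟩ := exists_volume_comparison (S := S) hμ hν hν0 hT hTfin a D
  obtain ⟨K', hK', hpre⟩ := exists_measure_preimage_nearFixedPoints_le (T := T) hμ hν hS hSfin b R
  have h1 := tendsto_measure_nearFixedPoints (X := X) hS hSfin hSfree R ht
  have h2 := tendsto_measure_nearFixedPoints (X := Y) hT hTfin hTfree (R + 1) hs
  have h3 := h1.add (h2.const_mul (K' * K))
  rw [mul_zero, add_zero] at h3
  filter_upwards [h3.eventually_lt_const hμ0, ht.eventually_ge_atTop (1 / (2 * ρ₀)),
    hs.eventually_ge_atTop (1 / (2 * ρ₀')), ht.eventually_gt_atTop 0,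
    hs.eventually_gt_atTop 0] with k hk htk hsk htk0 hsk0
  -- Otherwise the two bad sets cover `X`, while their total volume tends to zero: the factor `s ^
  -- n` in the preimage estimate is absorbed by `t ^ m` through the volume comparison.
  by_contra! hbad
  have hsub : (univ : Set X) ⊆ nearFixedPoints S X R (t k) ∪
      f k ⁻¹' nearFixedPoints T Y R (s k) := by
    intro x _
    by_cases hx : x ∈ nearFixedPoints S X R (t k)
    · exact Or.inl hx
    · exact Or.inr (hbad x hx)
  have h4 := (measureReal_mono hsub (measure_ne_top μ _)).trans (measureReal_union_le _ _)
  have h5 := hpre (t k) (s k) htk0 hsk (f k) (hb k)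
  have h6 := hvol (t k) (s k) htk hsk0 (f k) (ha k) (hD k)
  have h7 : K' * s k ^ n * ν.real (nearFixedPoints T Y (R + 1) (s k)) ≤
      K' * K * ν.real (nearFixedPoints T Y (R + 1) (s k)) * t k ^ m := by
    have h8 : K' * s k ^ n ≤ K' * (K * t k ^ m) := mul_le_mul_of_nonneg_left h6 hK'
    have h9 := mul_le_mul_of_nonneg_right h8
      (measureReal_nonneg (μ := ν) (s := nearFixedPoints T Y (R + 1) (s k)))
    linarith
  have h8 := le_of_mul_le_mul_right (h5.trans h7) (pow_pos htk0 m)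
  linarith

end GoodPoints

/-! ### Local models at high levels and the theorem -/

section Limit

variable {G : Type*} [Group G] {S : Set G} {X : Type*} [MetricSpace X] [MulAction G X]

lemma eventually_notMem_nearFixedPoints (hS : Subgroup.closure S = ⊤) (hfin : S.Finite) {x : X}
    (hx : MulAction.stabilizer G x = ⊥) {t : ℕ → ℝ} (ht : Tendsto t atTop atTop) (R : ℝ) :
    ∀ᶠ k in atTop, x ∉ nearFixedPoints S X R (t k) := by
  have : x ∉ ⋂ n : ℕ, nearFixedPoints S X R n :=
    fun h => iInter_nearFixedPoints_subset hS hfin R h hx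
  simp only [Set.mem_iInter, not_forall] at this
  obtain ⟨n, hn⟩ := this
  filter_upwards [ht.eventually_ge_atTop n] with k hk hxk
  exact hn (nearFixedPoints_anti hk hxk)

lemma eventually_isLocalModel_warpedDist [IsIsometricSMul G X] (hS : Subgroup.closure S = ⊤)
    {m : ℕ} {L r : ℝ} (hL : 1 ≤ L) (hr : 0 < r)
    (hch : HasUniformCharts m L r (Set.univ : Set X)) {R : ℝ} (hR : 0 ≤ R) {t : ℕ → ℝ}
    (ht : Tendsto t atTop atTop) :
    ∀ᶠ k in atTop, ∀ x ∉ nearFixedPoints S X (2 * R + 4 * L * R + 1) (t k),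
      IsLocalModel (prodIntDist S m) (1, 0) (warpedDist S (t k)) x
        (L + 1 + m * L) (1 + m * L + m) R := by
  filter_upwards [ht.eventually_gt_atTop 0,
    (ht.atTop_mul_const hr).eventually_gt_atTop (L * (R + 1) + m)] with k hk0 hk x hx
  exact isLocalModel_warpedDist hS hL hch hR hk0 hk hx

lemma IsAhlforsRegular.measure_univ_pos {X : Type*} [MetricSpace X] [MeasurableSpace X]
    [Nonempty X] {μ : Measure X} [IsFiniteMeasure μ] {m : ℕ} {c C ρ₀ : ℝ}
    (h : IsAhlforsRegular μ m c C ρ₀) : 0 < μ.real Set.univ := by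
  obtain ⟨x⟩ := ‹Nonempty X›
  have h1 := h.le_ball x ρ₀ h.radius_pos le_rfl
  have h2 : 0 < c * ρ₀ ^ m := mul_pos h.c_pos (pow_pos h.radius_pos m)
  exact h2.trans_le (h1.trans (measureReal_mono (Set.subset_univ _)))

end Limit

theorem theoremB
    {Γ : Type*} [Group Γ] (S : Finset Γ) (hS : Subgroup.closure (S : Set Γ) = ⊤)
    {Λ : Type*} [Group Λ] (S' : Finset Λ) (hS' : Subgroup.closure (S' : Set Λ) = ⊤)
    {m : ℕ} {M : Type*} [MetricSpace M] [ChartedSpace (EuclideanSpace ℝ (Fin m)) M]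
    [IsManifold (𝓡 m) ∞ M] [Bundle.RiemannianBundle (fun x : M => TangentSpace (𝓡 m) x)]
    [IsContMDiffRiemannianBundle (𝓡 m) ∞ (EuclideanSpace ℝ (Fin m))
      (fun x : M => TangentSpace (𝓡 m) x)]
    [IsRiemannianManifold (𝓡 m) M] [CompactSpace M] [Nonempty M]
    [MeasurableSpace M] [BorelSpace M]
    [MulAction Γ M] [IsIsometricSMul Γ M] (hM : IsEssentiallyFree Γ m M)
    (t : ℕ → ℝ) (ht_ge : ∀ k, 1 ≤ t k) (ht_mono : Monotone t) (ht : Tendsto t atTop atTop) :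
    (∀ {n : ℕ} {N : Type*} [MetricSpace N] [ChartedSpace (EuclideanSpace ℝ (Fin n)) N]
      [IsManifold (𝓡 n) ∞ N] [Bundle.RiemannianBundle (fun x : N => TangentSpace (𝓡 n) x)]
      [IsContMDiffRiemannianBundle (𝓡 n) ∞ (EuclideanSpace ℝ (Fin n))
        (fun x : N => TangentSpace (𝓡 n) x)]
      [IsRiemannianManifold (𝓡 n) N] [CompactSpace N] [Nonempty N]
      [MeasurableSpace N] [BorelSpace N]
      [MulAction Λ N] [IsIsometricSMul Λ N] (_ : IsEssentiallyFree Λ n N)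
      (s : ℕ → ℝ) (_ : ∀ k, 1 ≤ s k) (_ : Monotone s) (_ : Tendsto s atTop atTop)
      (_ : UniformlyCoarselyEquivalent (X := fun _ => M) (Y := fun _ => N)
        (fun k => warpedDist (S : Set Γ) (t k)) (fun k => warpedDist (S' : Set Λ) (s k))),
      QuasiIsometric (prodIntDist (S : Set Γ) m) (prodIntDist (S' : Set Λ) n)) ∧
    (∀ (K : ℕ → Subgroup Λ) [∀ k, (K k).Normal] [∀ k, (K k).FiniteIndex]
      (_ : ∀ k, K (k + 1) ≤ K k) (_ : ⨅ k, K k = ⊥)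
      (_ : UniformlyCoarselyEquivalent (X := fun k => Λ ⧸ K k) (Y := fun _ => M)
        (fun k => wordDist (QuotientGroup.mk' (K k) '' (S' : Set Λ)))
        (fun k => warpedDist (S : Set Γ) (t k))),
      QuasiIsometric (wordDist (S' : Set Λ)) (prodIntDist (S : Set Γ) m)) := by
  have hSfin : (S : Set Γ).Finite := S.finite_toSet
  have hS'fin : (S' : Set Λ).Finite := S'.finite_toSet
  have ht_pos : ∀ k, 0 < t k := fun k => zero_lt_one.trans_le (ht_ge k)
  have hwM : ∀ k, IsMetric (warpedDist (S : Set Γ) (t k) : M → M → ℝ) :=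
    fun k => isMetric_warpedDist (ht_pos k)
  have hΓ := isGraphMetric_prodIntDist hS m
  obtain ⟨L₁, r₁, hL₁, hr₁, hch₁⟩ := exists_hasUniformCharts m M
  have hfinM := isFiniteMeasure_hausdorffMeasure hL₁ hr₁ hch₁
  obtain ⟨c, C, ρ₀, hμ⟩ := exists_isAhlforsRegular hL₁ hr₁ hch₁
  refine ⟨?_, ?_⟩
  · intro n N _ _ _ _ _ _ _ _ _ _ _ _ hN s hs_ge _ hs hUCE
    have hs_pos : ∀ k, 0 < s k := fun k => zero_lt_one.trans_le (hs_ge k)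
    have hwN : ∀ k, IsMetric (warpedDist (S' : Set Λ) (s k) : N → N → ℝ) :=
      fun k => isMetric_warpedDist (hs_pos k)
    have hΛ := isGraphMetric_prodIntDist hS' n
    obtain ⟨L₂, r₂, hL₂, hr₂, hch₂⟩ := exists_hasUniformCharts n N
    have hfinN := isFiniteMeasure_hausdorffMeasure hL₂ hr₂ hch₂
    obtain ⟨c', C', ρ₀', hν⟩ := exists_isAhlforsRegular hL₂ hr₂ hch₂
    obtain ⟨f, hup, hlow, D, hD0, hD⟩ := hUCE.exists_maps hwM
    set L := max L₁ L₂
    have hL : 1 ≤ L := hL₁.trans (le_max_left _ _)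
    -- For each radius `j`, some level carries models around both `x` and its image. The levels
    -- chosen need not increase with `j`, since only `j` tending to infinity and the uniformity of
    -- the controls in `k` matter.
    have hmodel : ∀ j : ℕ, ∃ k, ∃ x : M,
        IsLocalModel (prodIntDist (S : Set Γ) m) (1, 0) (warpedDist (S : Set Γ) (t k)) x
          (max (L + 1 + m * L) (L + 1 + n * L)) (max (1 + m * L + m) (1 + n * L + n)) j ∧
        IsLocalModel (prodIntDist (S' : Set Λ) n) (1, 0) (warpedDist (S' : Set Λ) (s k)) (f k x)
          (max (L + 1 + m * L) (L + 1 + n * L)) (max (1 + m * L + m) (1 + n * L + n)) j := by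
      intro j
      obtain ⟨k, ⟨x, hx, hfx⟩, hkM, hkN⟩ :=
        ((eventually_exists_notMem_nearFixedPoints hμ hν hμ.measure_univ_pos hν.measure_univ_pos
          hS hSfin hS' hS'fin hM hN ht hs hup hlow hD (2 * j + 4 * L * j + 1)).and
        ((eventually_isLocalModel_warpedDist hS hL hr₁
          (hch₁.weaken (le_max_left _ _) hr₁ le_rfl) j.cast_nonneg ht).and
        (eventually_isLocalModel_warpedDist hS' hL hr₂
          (hch₂.weaken (le_max_right _ _) hr₂ le_rfl) j.cast_nonneg hs))).exists
      exact ⟨k, x, (hkM x hx).weaken hΓ.toIsMetric (hwM k) (le_max_left _ _) (le_max_left _ _),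
        (hkN _ hfx).weaken hΛ.toIsMetric (hwN k) (le_max_right _ _) (le_max_right _ _)⟩
    choose φ x hx hfx using hmodel
    refine quasiIsometric_of_localModels hΓ hΛ (finite_prodIntDist_ball hS hSfin m)
      (finite_prodIntDist_ball hS' hS'fin n) (fun j => hwM (φ j)) (fun j => hwN (φ j))
      (le_max_of_le_left (by positivity)) tendsto_natCast_atTop_atTop hx hfx (fun a => ?_)
      (fun a => ?_) (fun j => hD (φ j)) (fun j => ?_)
    · obtain ⟨b, hb⟩ := hup a
      exact ⟨b, fun j => hb (φ j)⟩
    · obtain ⟨b, hb⟩ := hlow a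
      exact ⟨b, fun j => hb (φ j)⟩
    · rw [(hwN _).self]
      exact hD0.le
  · intro K _ _ hK hbot hUCE
    have hΛ := isGraphMetric_wordDist hS'
    have hwQ : ∀ k, IsMetric (wordDist (QuotientGroup.mk' (K k) '' (S' : Set Λ))) :=
      fun k => (isGraphMetric_wordDist (closure_image_mk' (K k) hS')).toIsMetric
    obtain ⟨f, hup, hlow, D, -, hD⟩ := hUCE.exists_maps hwQ
    obtain ⟨y, hy⟩ : ∃ y : M, MulAction.stabilizer Γ y = ⊥ := by
      by_contra! h
      have h1 : {x : M | MulAction.stabilizer Γ x ≠ ⊥} = Set.univ := Set.eq_univ_of_forall h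
      have h2 := hμ.measure_univ_pos
      rw [measureReal_def, ← h1, hM] at h2
      exact h2.false
    -- Coarse preimages of one free point `y`; no further condition is needed, as quotient groups
    -- look the same around every point.
    choose x hx using fun k => hD k y
    have hmodel : ∀ j : ℕ, ∃ k,
        IsLocalModel (wordDist (S' : Set Λ)) 1
          (wordDist (QuotientGroup.mk' (K k) '' (S' : Set Λ))) (x k)
          (max 1 (L₁ + 1 + m * L₁)) (max 0 (1 + m * L₁ + m)) j ∧
        IsLocalModel (prodIntDist (S : Set Γ) m) (1, 0) (warpedDist (S : Set Γ) (t k)) y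
          (max 1 (L₁ + 1 + m * L₁)) (max 0 (1 + m * L₁ + m)) j := by
      intro j
      obtain ⟨k, hkK, hky, hkM⟩ :=
        ((eventually_inter_ball_trivial hS' hS'fin hK hbot (4 * j)).and
        ((eventually_notMem_nearFixedPoints hS hSfin hy ht (2 * j + 4 * L₁ * j + 1)).and
        (eventually_isLocalModel_warpedDist hS hL₁ hr₁ hch₁ j.cast_nonneg ht))).exists
      exact ⟨k, (isLocalModel_quotient hS' (K k) hkK (x k)).weaken hΛ.toIsMetric (hwQ k)
        (le_max_left _ _) (le_max_left _ _), (hkM y hky).weaken hΓ.toIsMetric (hwM k)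
        (le_max_right _ _) (le_max_right _ _)⟩
    choose φ hφx hφy using hmodel
    refine quasiIsometric_of_localModels hΛ hΓ (finite_wordDist_ball hS' hS'fin)
      (finite_prodIntDist_ball hS hSfin m) (fun j => hwQ (φ j)) (fun j => hwM (φ j))
      (le_max_of_le_left zero_le_one) tendsto_natCast_atTop_atTop hφx hφy (f := fun j => f (φ j))
      (fun a => ?_) (fun a => ?_) (fun j => hD (φ j)) (fun j => hx (φ j))
    · obtain ⟨b, hb⟩ := hup a
      exact ⟨b, fun j => hb (φ j)⟩
    · obtain ⟨b, hb⟩ := hlow a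
      exact ⟨b, fun j => hb (φ j)⟩
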